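/- **Setting.** Identify $S^1$ with $\mathbb{R}/2\pi\mathbb{Z}$, so that functions on $S^1$ are $2\pi$-periodic functions on $\mathbb{R}$. The Banach space $C^k(S^1;E)$ carries the norm $\|f\|_k=\max_{j\le k}\sup_\varphi\|f^{(j)}(\varphi)\|$. For $v=(x,y)\in\mathbb{R}^2$ put $v^\perp=(y,-x)$. Let $r>0$. For a continuous embedding $\gamma\colon S^1\to\mathbb{R}^2$ let $\operatorname{inn}(\gamma)$ be the bounded component of $\mathbb{R}^2\setminus\gamma(S^1)$, and let the circular integral invariant of $\gamma$ be $$I_r[\gamma](\varphi)=\operatorname{area}\bigl(B_r(\gamma(\varphi))\cap \operatorname{inn}(\gamma)\bigr),$$ where $B_r(x)$ is the disc of radius $r$ centred at $x$. Let $$p_\gamma(\varphi)=\inf\{\psi>\varphi:\ |\gamma(\psi)-\gamma(\varphi)|=r\},\qquad m_\gamma(\varphi)=\sup\{\psi<\varphi:\ |\gamma(\psi)-\gamma(\varphi)|=r\}$$ be the next and the previous parameter at which $\gamma$ meets the circle of radius $r$ centred at $\gamma(\varphi)$. **Theorem.** Let $k\ge 0$, $\ell\ge 1$, $r>0$ and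 $R>r/2$. There is an open neighbourhood $\mathcal{V}\subset C^{k+\ell+1}(S^1;\mathbb{R}^2)$ of the circle $\varphi\mapsto(R\cos\varphi,R\sin\varphi)$ such that every $\gamma\in\mathcal{V}$ is an embedding, for every $\gamma\in\mathcal V$ and every $\varphi$ the circle of radius $r$ centred at $\gamma(\varphi)$ meets $\gamma$ at exactly two parameters modulo $2\pi$, namely $p_\gamma(\varphi)$ and $m_\gamma(\varphi)$, with $p_\gamma(\varphi)<m_\gamma(\varphi)+2\pi$, and the following hold. (Here $\gamma,\sigma,p_\gamma,m_\gamma$ without argument are evaluated at $\varphi$; $\gamma(p_\gamma)$ means $\gamma(p_\gamma(\varphi))$, and so on.) 1. For every $\gamma\in\mathcal{V}$ and $\varphi\in S^1$, $$I_r[\gamma](\varphi)=\frac12\int_{m_\gamma}^{p_\gamma}\langle\gamma(\psi)-\gamma,\dot\gamma(\psi)^\perp\rangle\,d\psi+\frac{r^2}{2}\arccos\Bigl(\frac{\langle\gamma(p_\gamma)-\gamma,\gamma(m_\gamma)-\gamma\rangle}{r^2}\Bigr).$$ 2. For every $\gamma\in\mathcal V$ the function $I_r[\gamma]$ belongs to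 $C^k(S^1;\mathbb{R})$, and the map $I_r\colon\mathcal{V}\to C^k(S^1;\mathbb{R})$ is $\ell$ times continuously Fréchet differentiable. For $\gamma\in\mathcal{V}$ and $\varphi\in S^1$ the numbers $\langle\dot\gamma(p_\gamma),\gamma(p_\gamma)-\gamma\rangle$ and $\langle\dot\gamma(m_\gamma),\gamma(m_\gamma)-\gamma\rangle$ are nonzero and $r^4-\langle\gamma(p_\gamma)-\gamma,\gamma(m_\gamma)-\gamma\rangle^2>0$; writing, for $\sigma\in C^{k+\ell+1}(S^1;\mathbb{R}^2)$, $$P=\frac{\langle\sigma-\sigma(p_\gamma),\gamma(p_\gamma)-\gamma\rangle}{\langle\dot\gamma(p_\gamma),\gamma(p_\gamma)-\gamma\rangle},\qquad M=\frac{\langle\sigma-\sigma(m_\gamma),\gamma(m_\gamma)-\gamma\rangle}{\langle\dot\gamma(m_\gamma),\gamma(m_\gamma)-\gamma\rangle},$$ the derivative in direction $\sigma$ is given by $$\begin{aligned}2I_r'[\gamma](\sigma)(\varphi)={}&2\int_{m_\gamma}^{p_\gamma}\langle\sigma(\psi),\dot\gamma(\psi)^\perp\rangle\,d\psi-\lan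gle\sigma,\gamma(p_\gamma)^\perp-\gamma(m_\gamma)^\perp\rangle\\&+\langle\gamma(p_\gamma)-\gamma,\sigma(p_\gamma)^\perp\rangle-\langle\gamma(m_\gamma)-\gamma,\sigma(m_\gamma)^\perp\rangle\\&+\langle\gamma(p_\gamma)-\gamma,\dot\gamma(p_\gamma)^\perp\rangle\,P-\langle\gamma(m_\gamma)-\gamma,\dot\gamma(m_\gamma)^\perp\rangle\,M\\&-\frac{r^2}{\sqrt{r^4-\langle\gamma(p_\gamma)-\gamma,\gamma(m_\gamma)-\gamma\rangle^2}}\Bigl(P\,\langle\dot\gamma(p_\gamma),\gamma(m_\gamma)-\gamma\rangle+\langle\sigma(p_\gamma)-\sigma,\gamma(m_\gamma)-\gamma\rangle\\&\qquad+\langle\gamma(p_\gamma)-\gamma,\sigma(m_\gamma)-\sigma\rangle+M\,\langle\gamma(p_\gamma)-\gamma,\dot\gamma(m_\gamma)\rangle\Bigr).\end{aligned}$$ -/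

import Mathlib

open Set MeasureTheory
open scoped Real

noncomputable section

namespace CircInv

/-- The Euclidean plane. -/
abbrev Plane : Type := EuclideanSpace ℝ (Fin 2)

section CkSpace

variable (k : ℕ) (E : Type*) [NormedAddCommGroup E] [NormedSpace ℝ E]

/-- The `2π`-periodic functions of class `C^k` on the real line, as a linear subspace of all
functions. -/
def ckSubmodule : Submodule ℝ (ℝ → E) where
  carrier := {f | Function.Periodic f (2 * π) ∧ ContDiff ℝ k f}
  add_mem' := fun hf hg => ⟨hf.1.add hg.1, hf.2.add hg.2⟩
  zero_mem' := ⟨fun _ => rfl, contDiff_const⟩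
  smul_mem' := fun c _ hf => ⟨hf.1.smul c, contDiff_const.smul hf.2⟩

/-- The space `C^k(S¹; E)`, where functions on `S¹ = ℝ / 2πℤ` are regarded as `2π`-periodic functions
on the real line. (A definition and not an abbreviation, so that it carries only the `C^k`-norm
topology introduced below and not the topology of pointwise convergence.) -/
def CkCircle : Type _ := ckSubmodule k E

instance : AddCommGroup (CkCircle k E) := inferInstanceAs (AddCommGroup (ckSubmodule k E))

instance : Module ℝ (CkCircle k E) := inferInstanceAs (Module ℝ (ckSubmodule k E))

variable {k E}

instance : CoeFun (CkCircle k E) (fun _ => ℝ → E) := ⟨fun f => f.1⟩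

theorem CkCircle.periodic (f : CkCircle k E) : Function.Periodic f (2 * π) := f.2.1

theorem CkCircle.contDiff (f : CkCircle k E) : ContDiff ℝ k f := f.2.2

theorem CkCircle.periodic_iteratedDeriv (f : CkCircle k E) (j : ℕ) :
    Function.Periodic (iteratedDeriv j f) (2 * π) := by
  intro x
  have h := congrFun (iteratedDeriv_comp_add_const (n := j) (f := f) (s := 2 * π)) x
  rw [← h]
  congr 1
  funext z
  exact f.periodic z

theorem CkCircle.continuous_iteratedDeriv (f : CkCircle k E) (j : Fin (k + 1)) :
    Continuous (iteratedDeriv (j : ℕ) f) :=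
  f.contDiff.continuous_iteratedDeriv j (by exact_mod_cast Nat.lt_succ_iff.mp j.2)

/-- The `j`-th derivative (`j ≤ k`) of an element of `C^k(S¹; E)`, as a bounded continuous
function. -/
def CkCircle.derivBCF (f : CkCircle k E) (j : Fin (k + 1)) : BoundedContinuousFunction ℝ E :=
  BoundedContinuousFunction.mkOfBound ⟨iteratedDeriv (j : ℕ) f, f.continuous_iteratedDeriv j⟩
    (Metric.diam (range (iteratedDeriv (j : ℕ) f)))
    (fun x y => Metric.dist_le_diam_of_mem
      ((f.periodic_iteratedDeriv j).isBounded_of_continuous (by positivity)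
        (f.continuous_iteratedDeriv j)) (mem_range_self x) (mem_range_self y))

variable (k E)

/-- The linear map `f ↦ (f, f', …, f^(k))` into the `(k+1)`-fold product of the space of bounded
continuous functions. -/
def CkCircle.jet : CkCircle k E →ₗ[ℝ] (Fin (k + 1) → BoundedContinuousFunction ℝ E) where
  toFun f j := f.derivBCF j
  map_add' f g := by
    funext j
    ext x
    have hj : ((j : ℕ) : WithTop ℕ∞) ≤ k := by exact_mod_cast Nat.lt_succ_iff.mp j.2
    exact iteratedDeriv_add (f.contDiff.contDiffAt.of_le hj) (g.contDiff.contDiffAt.of_le hj)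
  map_smul' c f := by
    funext j
    ext x
    have hj : ((j : ℕ) : WithTop ℕ∞) ≤ k := by exact_mod_cast Nat.lt_succ_iff.mp j.2
    exact iteratedDeriv_const_smul (f.contDiff.contDiffAt.of_le hj) c

theorem CkCircle.jet_injective : Function.Injective (CkCircle.jet k E) := by
  intro f g h
  apply Subtype.ext
  funext x
  have h0 := congrArg (fun F : BoundedContinuousFunction ℝ E => F x) (congrFun h 0)
  exact h0

/-- The `C^k`-norm `‖f‖ = max_{j ≤ k} sup_φ ‖f^(j)(φ)‖`. -/
instance : NormedAddCommGroup (CkCircle k E) :=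
  NormedAddCommGroup.induced (CkCircle k E) (Fin (k + 1) → BoundedContinuousFunction ℝ E)
    (CkCircle.jet k E) (CkCircle.jet_injective k E)

instance : NormedSpace ℝ (CkCircle k E) :=
  NormedSpace.induced ℝ (CkCircle k E) (Fin (k + 1) → BoundedContinuousFunction ℝ E)
    (CkCircle.jet k E)

end CkSpace

/-- The constant speed parametrization `φ ↦ (R cos φ, R sin φ)` of the circle of radius `R`. -/
def circleCurve (k : ℕ) (R : ℝ) : CkCircle k Plane :=
  ⟨fun φ => !₂[R * Real.cos φ, R * Real.sin φ], by
    refine ⟨fun φ => ?_, ?_⟩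
    · simp
    · rw [contDiff_euclidean]
      intro i
      fin_cases i
      · exact contDiff_const.mul Real.contDiff_cos
      · exact contDiff_const.mul Real.contDiff_sin⟩

/-- A `2π`-periodic curve is an embedding of the circle if it is injective on a period. -/
def IsEmbedded (γ : ℝ → Plane) : Prop := InjOn γ (Ico 0 (2 * π))

/-- The interior of a closed curve: the union of the bounded connected components of the complement
of its trace (for a Jordan curve there is exactly one). -/
def inn (γ : ℝ → Plane) : Set Plane :=
  {x | x ∉ range γ ∧ Bornology.IsBounded (connectedComponentIn (range γ)ᶜ x)}

/-- The circular integral invariant `I_r[γ](φ)`: the area of `B_r(γ(φ)) ∩ inn(γ)`. -/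
def invariant (r : ℝ) (γ : ℝ → Plane) (φ : ℝ) : ℝ :=
  (volume (Metric.ball (γ φ) r ∩ inn γ)).toReal

/-- `p_γ(φ)`: the next parameter after `φ` at which `γ` meets the circle of radius `r` centred
at `γ(φ)`. -/
def nextParam (r : ℝ) (γ : ℝ → Plane) (φ : ℝ) : ℝ :=
  sInf {ψ | φ < ψ ∧ dist (γ ψ) (γ φ) = r}

/-- `m_γ(φ)`: the last parameter before `φ` at which `γ` meets the circle of radius `r` centred
at `γ(φ)`. -/
def prevParam (r : ℝ) (γ : ℝ → Plane) (φ : ℝ) : ℝ :=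
  sSup {ψ | ψ < φ ∧ dist (γ ψ) (γ φ) = r}

/-- Clockwise rotation by a right angle, `(x, y)^⊥ = (y, -x)`. -/
def perp (v : Plane) : Plane := !₂[v 1, -v 0]

/-- The Euclidean inner product of the plane. -/
local notation "⟪" v ", " w "⟫" => (Inner.inner ℝ (v : Plane) (w : Plane) : ℝ)

/-- The right-hand side of the formula for `I_r[γ](φ)`. -/
def invariantFormula (r : ℝ) (γ : ℝ → Plane) (φ : ℝ) : ℝ :=
  let p := nextParam r γ φ
  let m := prevParam r γ φ
  1 / 2 * (∫ ψ in m..p, ⟪γ ψ - γ φ, perp (deriv γ ψ)⟫)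
    + r ^ 2 / 2 * Real.arccos (⟪γ p - γ φ, γ m - γ φ⟫ / r ^ 2)

/-- The right-hand side of the formula for `2 I_r'[γ](σ)(φ)`. -/
def twiceDerivFormula (r : ℝ) (γ σ : ℝ → Plane) (φ : ℝ) : ℝ :=
  let p := nextParam r γ φ
  let m := prevParam r γ φ
  2 * (∫ ψ in m..p, ⟪σ ψ, perp (deriv γ ψ)⟫)
    - ⟪σ φ, perp (γ p) - perp (γ m)⟫
    + ⟪γ p - γ φ, perp (σ p)⟫
    - ⟪γ m - γ φ, perp (σ m)⟫
    + ⟪γ p - γ φ, perp (deriv γ p)⟫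
        * (⟪σ φ - σ p, γ p - γ φ⟫ / ⟪deriv γ p, γ p - γ φ⟫)
    - ⟪γ m - γ φ, perp (deriv γ m)⟫
        * (⟪σ φ - σ m, γ m - γ φ⟫ / ⟪deriv γ m, γ m - γ φ⟫)
    - r ^ 2 / √(r ^ 4 - ⟪γ p - γ φ, γ m - γ φ⟫ ^ 2)
        * (⟪σ φ - σ p, γ p - γ φ⟫ / ⟪deriv γ p, γ p - γ φ⟫ * ⟪deriv γ p, γ m - γ φ⟫
          + ⟪σ p - σ φ, γ m - γ φ⟫
          + ⟪γ p - γ φ, σ m - σ φ⟫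
          + ⟪σ φ - σ m, γ m - γ φ⟫ / ⟪deriv γ m, γ m - γ φ⟫ * ⟪γ p - γ φ, deriv γ m⟫)

/-- The circle of radius `r` centred at `γ(φ)` meets the closed curve `γ` at exactly two parameters
per period, namely `p_γ(φ)` and `m_γ(φ)` (modulo `2π`). -/
def MeetsTwice (r : ℝ) (γ : ℝ → Plane) (φ : ℝ) : Prop :=
  {ψ ∈ Ioo φ (φ + 2 * π) | dist (γ ψ) (γ φ) = r}
      = {nextParam r γ φ, prevParam r γ φ + 2 * π}
    ∧ nextParam r γ φ < prevParam r γ φ + 2 * π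

/-- None of the denominators in the formula for `I_r'[γ]` vanishes. -/
def NonDegenerate (r : ℝ) (γ : ℝ → Plane) (φ : ℝ) : Prop :=
  let p := nextParam r γ φ
  let m := prevParam r γ φ
  ⟪deriv γ p, γ p - γ φ⟫ ≠ 0 ∧ ⟪deriv γ m, γ m - γ φ⟫ ≠ 0
    ∧ 0 < r ^ 4 - ⟪γ p - γ φ, γ m - γ φ⟫ ^ 2

end CircInv

end

/-! Everything rests on a few features of the circle that survive `C²`-small perturbation, collected
in `NearCircle`: the curve lies strictly to the left of each of its tangents, and the distance from
`γ φ` increases strictly up to parameter distance `x₁` and exceeds `r` beyond it.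

Area formula. The tangent condition makes the determinant of any two chords from `γ φ` positive
(`NearCircle.cross_chords_pos`), so the open chords from `γ φ` sweep out the interior injectively
(`NearCircle.inn_eq`), with Jacobian `s * cross (chord) (deriv γ)` up to sign. Cutting each chord
where it leaves the disc turns the area into a single integral. While the curve is within distance
`r` the integrand is half the area form; while it is farther away it is `r ^ 2 / 2` times the
angular velocity of the chord, whose integral is the arccosine.

Smoothness. The parameters `p` and `m` solve `‖γ ψ - γ φ‖ ^ 2 = r ^ 2` nondegenerately, so the
implicit function theorem on `C^(k+ℓ+1) × ℝ` applies. Evaluation `(γ, s) ↦ γ s` is jointly `C^(k+ℓ)`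
there, losing one derivative. The area form involves `deriv γ`, which costs another, but integration
in `s` regains it. Thus the formula is `C^(k+ℓ)` in `(γ, φ)`, and the exponential law
`contDiffOn_ckCircle_of_uncurry` converts this into a `C^ℓ` map into `C^k`.

Derivative. Evaluation at `φ` is continuous and linear, so it suffices to differentiate the formula
at fixed `φ` along `γ + t • σ`; an integration by parts removes the derivative of `σ`. -/

open scoped Topology

noncomputable section

namespace CircInv

local notation "⟪" v ", " w "⟫" => (Inner.inner ℝ (v : Plane) (w : Plane) : ℝ)

/-! ### Completeness of `C^k(S¹; E)` and smoothness of evaluation in operator norm. -/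

namespace CkCircle

variable {k : ℕ} {E : Type*} [NormedAddCommGroup E] [NormedSpace ℝ E]

/-- The element of `C^k(S¹; E)` given by a periodic function of class `C^k`. -/
def ofPeriodic (f : ℝ → E) (hp : Function.Periodic f (2 * π)) (hf : ContDiff ℝ k f) :
    CkCircle k E :=
  ⟨f, hp, hf⟩

@[simp]
theorem coe_ofPeriodic (f : ℝ → E) (hp : Function.Periodic f (2 * π)) (hf : ContDiff ℝ k f) :
    (ofPeriodic f hp hf : ℝ → E) = f := rfl

variable (k E) in
/-- The jet map as a linear isometry. -/
def jetIsometry : CkCircle k E →ₗᵢ[ℝ] (Fin (k + 1) → BoundedContinuousFunction ℝ E) :=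
  { jet k E with norm_map' := fun _ => rfl }

@[ext]
theorem ext {f g : CkCircle k E} (h : ∀ x, f x = g x) : f = g := Subtype.ext (funext h)

@[simp]
theorem add_apply (f g : CkCircle k E) (x : ℝ) : (f + g) x = f x + g x := rfl

@[simp]
theorem sub_apply (f g : CkCircle k E) (x : ℝ) : (f - g) x = f x - g x := rfl

@[simp]
theorem smul_apply (c : ℝ) (f : CkCircle k E) (x : ℝ) : (c • f) x = c • f x := rfl

theorem norm_iteratedDeriv_le (f : CkCircle k E) {j : ℕ} (hj : j ≤ k) (x : ℝ) :
    ‖iteratedDeriv j f x‖ ≤ ‖f‖ := by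
  rw [← (jetIsometry k E).norm_map f]
  exact ((jetIsometry k E f ⟨j, Nat.lt_succ_of_le hj⟩).norm_coe_le_norm x).trans
    (norm_le_pi_norm (jetIsometry k E f) ⟨j, Nat.lt_succ_of_le hj⟩)

theorem norm_le_of_iteratedDeriv_le (f : CkCircle k E) {C : ℝ} (hC : 0 ≤ C)
    (h : ∀ j ≤ k, ∀ x, ‖iteratedDeriv j f x‖ ≤ C) : ‖f‖ ≤ C := by
  rw [← (jetIsometry k E).norm_map f, pi_norm_le_iff_of_nonneg hC]
  exact fun j => (BoundedContinuousFunction.norm_le hC).2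
    fun x => h j (Nat.lt_succ_iff.mp j.2) x

theorem hasDerivAt_iteratedDeriv (f : CkCircle k E) {j : ℕ} (hj : j < k) (x : ℝ) :
    HasDerivAt (iteratedDeriv j f) (iteratedDeriv (j + 1) f x) x := by
  rw [iteratedDeriv_succ]
  exact (f.contDiff.differentiable_iteratedDeriv j (by exact_mod_cast hj) x).hasDerivAt

theorem norm_iteratedDeriv_sub_le (f : CkCircle k E) {j : ℕ} (hj : j < k) (s t : ℝ) :
    ‖iteratedDeriv j f t - iteratedDeriv j f s‖ ≤ ‖f‖ * |t - s| := by
  have := convex_univ.norm_image_sub_le_of_norm_hasDerivWithin_le (f := iteratedDeriv j f)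
    (fun x _ => (f.hasDerivAt_iteratedDeriv hj x).hasDerivWithinAt)
    (fun x _ => f.norm_iteratedDeriv_le (Nat.succ_le_of_lt hj) x) (mem_univ s) (mem_univ t)
  simpa using this

/-- The mean value inequality, applied to the remainder itself. The bound is linear in `‖f‖`, hence
uniform on the unit ball. -/
theorem norm_iteratedDeriv_taylor_le (f : CkCircle k E) {j : ℕ} (hj : j + 1 < k) (s t : ℝ) :
    ‖iteratedDeriv j f t - iteratedDeriv j f s - (t - s) • iteratedDeriv (j + 1) f s‖
      ≤ ‖f‖ * |t - s| * |t - s| := by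
  have hd : ∀ x, HasDerivAt
      (fun x => iteratedDeriv j f x - (x - s) • iteratedDeriv (j + 1) f s)
      (iteratedDeriv (j + 1) f x - iteratedDeriv (j + 1) f s) x := fun x => by
    simpa using (f.hasDerivAt_iteratedDeriv (by omega : j < k) x).fun_sub
      (((hasDerivAt_id x).sub_const s).smul_const (iteratedDeriv (j + 1) f s))
  have := (convex_uIcc s t).norm_image_sub_le_of_norm_hasDerivWithin_le
    (C := ‖f‖ * |t - s|) (fun x _ => (hd x).hasDerivWithinAt)
    (fun x hx => (f.norm_iteratedDeriv_sub_le hj s x).trans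
      (mul_le_mul_of_nonneg_left (abs_sub_left_of_mem_uIcc hx) (norm_nonneg f)))
    left_mem_uIcc right_mem_uIcc
  simp only [sub_self, zero_smul, sub_zero, Real.norm_eq_abs] at this
  rwa [sub_right_comm]

/-- The range of the isometric jet map is closed: uniform limits of a function and its derivatives
are still linked by differentiation. Completeness serves the implicit function theorem and the
vector-valued integrals in the exponential law. -/
instance [CompleteSpace E] : CompleteSpace (CkCircle k E) := by
  have hi : Isometry (jetIsometry k E) := (jetIsometry k E).isometry
  rw [completeSpace_iff_isComplete_range hi.isUniformInducing]
  refine IsClosed.isComplete (IsSeqClosed.isClosed fun u g hu hg => ?_)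
  choose f hf using hu
  have hlim : ∀ j : Fin (k + 1),
      TendstoUniformly (fun i => iteratedDeriv (j : ℕ) (f i)) (g j) Filter.atTop := by
    intro j
    have := BoundedContinuousFunction.tendsto_iff_tendstoUniformly.1 ((tendsto_pi_nhds.1 hg) j)
    simp only [← hf] at this
    exact this
  have hder : ∀ j (hj : j + 1 < k + 1) x,
      HasDerivAt (g ⟨j, by omega⟩) (g ⟨j + 1, hj⟩ x) x := fun j hj x =>
    hasDerivAt_of_tendstoUniformly (hlim ⟨j + 1, hj⟩)
      (.of_forall fun i x => (f i).hasDerivAt_iteratedDeriv (by omega) x)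
      (fun x => (hlim ⟨j, by omega⟩).tendsto_at x) x
  have hit : ∀ j (hj : j < k + 1), iteratedDeriv j (g 0) = g ⟨j, hj⟩ := by
    intro j
    induction j with
    | zero => intro hj; rw [iteratedDeriv_zero]; rfl
    | succ j ih =>
      intro hj
      rw [iteratedDeriv_succ, ih (by omega)]
      exact funext fun x => (hder j hj x).deriv
  have hper : Function.Periodic (g 0) (2 * π) := fun x => by
    refine tendsto_nhds_unique ((hlim 0).tendsto_at (x + 2 * π)) ?_
    refine ((hlim 0).tendsto_at x).congr fun i => ?_
    exact ((f i).periodic_iteratedDeriv _ x).symm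
  have hcd : ContDiff ℝ k (g 0) := by
    refine contDiff_nat_iff_iteratedDeriv.2 ⟨fun m hm => ?_, fun m hm => ?_⟩
    · rw [hit m (by omega)]
      exact (g _).continuous
    · rw [hit m (by omega)]
      exact fun x => (hder m (by omega) x).differentiableAt
  refine ⟨⟨g 0, hper, hcd⟩, ?_⟩
  funext j
  ext x
  exact congrFun (hit j j.2) x

/-- The evaluation `f ↦ f^(j)(s)` of the `j`-th derivative, as a continuous linear functional. -/
def evJet {j : ℕ} (hj : j ≤ k) (s : ℝ) : CkCircle k E →L[ℝ] E :=
  (BoundedContinuousFunction.evalCLM ℝ s) ∘L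
    (ContinuousLinearMap.proj (R := ℝ) (⟨j, Nat.lt_succ_of_le hj⟩ : Fin (k + 1))) ∘L
      (jetIsometry k E).toContinuousLinearMap

theorem evJet_apply {j : ℕ} (hj : j ≤ k) (s : ℝ) (f : CkCircle k E) :
    evJet hj s f = iteratedDeriv j f s := rfl

theorem evJet_zero_apply (s : ℝ) (f : CkCircle k E) :
    evJet (Nat.zero_le k) s f = f s := by
  rw [evJet_apply, iteratedDeriv_zero]

theorem evJet_one_apply (hk : 1 ≤ k) (s : ℝ) (f : CkCircle k E) :
    evJet hk s f = deriv f s := by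
  rw [evJet_apply, iteratedDeriv_one]

/-- The derivative is taken in operator norm, so the remainder must be small uniformly in `f`. This
costs one more derivative than the pointwise statement, hence `j + 2 ≤ k`. -/
theorem hasDerivAt_evJet {j : ℕ} (hj : j + 2 ≤ k) (s : ℝ) :
    HasDerivAt (fun s => (evJet (by omega : j ≤ k) s : CkCircle k E →L[ℝ] E))
      (evJet (by omega : j + 1 ≤ k) s) s := by
  rw [hasDerivAt_iff_isLittleO]
  refine Asymptotics.IsBigO.trans_isLittleO (g := fun t => (t - s) * (t - s)) ?_ ?_
  · refine Asymptotics.isBigO_of_le _ fun t => ?_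
    refine ContinuousLinearMap.opNorm_le_bound _ (norm_nonneg _) fun f => ?_
    have := f.norm_iteratedDeriv_taylor_le (by omega : j + 1 < k) s t
    rw [norm_mul, Real.norm_eq_abs, mul_comm _ ‖f‖, ← mul_assoc]
    exact this
  · have h0 : (fun t => t - s) =o[𝓝 s] (fun _ => (1 : ℝ)) := by
      rw [Asymptotics.isLittleO_one_iff]
      exact (continuous_id.sub continuous_const).tendsto' _ _ (sub_self s)
    simpa using h0.mul_isBigO (Asymptotics.isBigO_refl (fun t => t - s) (𝓝 s))

theorem continuous_evJet {j : ℕ} (hj : j + 1 ≤ k) :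
    Continuous (fun s => (evJet (by omega : j ≤ k) s : CkCircle k E →L[ℝ] E)) := by
  refine LipschitzWith.continuous (K := 1) (LipschitzWith.of_dist_le_mul fun t s => ?_)
  rw [dist_eq_norm, NNReal.coe_one, one_mul]
  refine ContinuousLinearMap.opNorm_le_bound _ dist_nonneg fun f => ?_
  rw [mul_comm]
  exact f.norm_iteratedDeriv_sub_le (by omega : j < k) s t

/-- In operator norm, evaluation of the `j`-th derivative of a `C^k` function depends in a
`C^(k-j-1)` way on the point. -/
theorem contDiff_evJet {m j : ℕ} (hj : j + m + 1 ≤ k) :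
    ContDiff ℝ m (fun s => (evJet (by omega : j ≤ k) s : CkCircle k E →L[ℝ] E)) := by
  induction m generalizing j with
  | zero => exact contDiff_zero.2 (continuous_evJet (by omega))
  | succ m ih =>
    push_cast
    rw [contDiff_succ_iff_deriv]
    have hd := fun s => hasDerivAt_evJet (E := E) (j := j) (k := k) (by omega) s
    refine ⟨fun s => (hd s).differentiableAt, by simp, ?_⟩
    rw [funext fun s => (hd s).deriv]
    exact ih (j := j + 1) (by omega)

end CkCircle

/-! ### Jointly smooth families as smooth maps into `C^k(S¹; E)`. -/

section ExponentialLaw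

universe u

variable {X E : Type u} [NormedAddCommGroup X] [NormedSpace ℝ X]
  [NormedAddCommGroup E] [NormedSpace ℝ E]

/-- The curve of vectors obtained by applying a curve of operators to a fixed vector. -/
def CkCircle.applyVec {k : ℕ} (T : CkCircle k (X →L[ℝ] E)) (h : X) : CkCircle k E :=
  .ofPeriodic (fun φ => T φ h) (fun φ => by simp only [T.periodic φ])
    (T.contDiff.clm_apply contDiff_const)

theorem CkCircle.iteratedDeriv_applyVec {k : ℕ} (T : CkCircle k (X →L[ℝ] E)) (h : X)
    {j : ℕ} (hj : j ≤ k) : iteratedDeriv j (T.applyVec h) = fun φ => iteratedDeriv j T φ h := by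
  induction j with
  | zero => simp only [iteratedDeriv_zero]; rfl
  | succ j ih =>
    rw [iteratedDeriv_succ, ih (by omega)]
    funext φ
    exact ((T.hasDerivAt_iteratedDeriv (by omega) φ).clm_apply
      (hasDerivAt_const φ h)).deriv.trans (by simp)

variable (X E) in
/-- The natural map `C^k(S¹; L(X, E)) → L(X, C^k(S¹; E))`. -/
def CkCircle.applyCLM (k : ℕ) :
    CkCircle k (X →L[ℝ] E) →L[ℝ] (X →L[ℝ] CkCircle k E) :=
  LinearMap.mkContinuous₂
    (LinearMap.mk₂ ℝ (fun T h => CkCircle.applyVec T h) (fun _ _ _ => CkCircle.ext fun _ => rfl)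
      (fun _ _ _ => CkCircle.ext fun _ => rfl)
      (fun T h h' => CkCircle.ext fun φ => (T φ).map_add h h')
      (fun c T h => CkCircle.ext fun φ => (T φ).map_smul c h)) 1
    (fun T h => by
      refine CkCircle.norm_le_of_iteratedDeriv_le _ (by positivity) fun j hj φ => ?_
      rw [one_mul]
      change ‖iteratedDeriv j (CkCircle.applyVec T h) φ‖ ≤ _
      rw [CkCircle.iteratedDeriv_applyVec T h hj]
      exact ((iteratedDeriv j T φ).le_opNorm h).trans
        (mul_le_mul_of_nonneg_right (T.norm_iteratedDeriv_le hj φ) (norm_nonneg h)))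

variable {V : Set X} {F : X → ℝ → E}

theorem hasDerivAt_of_contDiffOn_uncurry {m : WithTop ℕ∞} (hm : m ≠ 0) (hV : IsOpen V)
    (hF : ContDiffOn ℝ m (Function.uncurry F) (V ×ˢ univ)) {x : X} (hx : x ∈ V) (φ : ℝ) :
    HasDerivAt (F x) (fderiv ℝ (Function.uncurry F) (x, φ) (0, 1)) φ := by
  have h := ((hF.contDiffAt ((hV.prod isOpen_univ).mem_nhds
    (⟨hx, mem_univ φ⟩ : (x, φ) ∈ V ×ˢ univ))).differentiableAt hm).hasFDerivAt
  exact h.comp_hasDerivAt φ ((hasDerivAt_const φ x).prodMk (hasDerivAt_id φ))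

theorem hasFDerivAt_of_contDiffOn_uncurry {m : WithTop ℕ∞} (hm : m ≠ 0) (hV : IsOpen V)
    (hF : ContDiffOn ℝ m (Function.uncurry F) (V ×ˢ univ)) {x : X} (hx : x ∈ V) (φ : ℝ) :
    HasFDerivAt (fun x => F x φ)
      (fderiv ℝ (Function.uncurry F) (x, φ) ∘L ContinuousLinearMap.inl ℝ X ℝ) x := by
  have h := ((hF.contDiffAt ((hV.prod isOpen_univ).mem_nhds
    (⟨hx, mem_univ φ⟩ : (x, φ) ∈ V ×ˢ univ))).differentiableAt hm).hasFDerivAt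
  exact h.comp (f := fun x => (x, φ)) x (hasFDerivAt_prodMk_left x φ)

theorem contDiff_of_contDiffOn_uncurry {m : WithTop ℕ∞}
    (hF : ContDiffOn ℝ m (Function.uncurry F) (V ×ˢ univ)) {x : X} (hx : x ∈ V) :
    ContDiff ℝ m (F x) := by
  rw [← contDiffOn_univ]
  exact hF.comp (contDiff_prodMk_right x).contDiffOn fun φ _ => ⟨hx, mem_univ φ⟩

theorem contDiffOn_uncurry_deriv {m : WithTop ℕ∞} (hV : IsOpen V)
    (hF : ContDiffOn ℝ (m + 1) (Function.uncurry F) (V ×ˢ univ)) :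
    ContDiffOn ℝ m (Function.uncurry fun x φ => deriv (F x) φ) (V ×ˢ univ) := by
  refine ((hF.fderiv_of_isOpen (hV.prod isOpen_univ) le_rfl).clm_apply
    (contDiffOn_const (c := ((0 : X), (1 : ℝ))))).congr ?_
  rintro ⟨x, φ⟩ ⟨hx, -⟩
  exact (hasDerivAt_of_contDiffOn_uncurry (by simp) hV hF hx φ).deriv

theorem contDiffOn_uncurry_iteratedDeriv {m : ℕ} (hV : IsOpen V) (j : ℕ)
    (hF : ContDiffOn ℝ (j + m : ℕ) (Function.uncurry F) (V ×ˢ univ)) :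
    ContDiffOn ℝ m (Function.uncurry fun x φ => iteratedDeriv j (F x) φ) (V ×ˢ univ) := by
  induction j generalizing m with
  | zero => simpa only [iteratedDeriv_zero, zero_add] using hF
  | succ j ih =>
    have h : ContDiffOn ℝ (j + (m + 1) : ℕ) (Function.uncurry F) (V ×ˢ univ) := by
      rwa [show j + (m + 1) = j + 1 + m by omega]
    have := contDiffOn_uncurry_deriv hV (m := m) (by exact_mod_cast ih h)
    simpa only [iteratedDeriv_succ] using this

/-- Each derivative in `φ` up to order `k` is jointly continuous. Compactness of one period makes
the dependence on `x` uniform in `φ`, and periodicity extends this to the line. -/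
theorem continuousOn_ckCircle_of_uncurry {k : ℕ} (hV : IsOpen V)
    (hF : ContDiffOn ℝ k (Function.uncurry F) (V ×ˢ univ)) {J : X → CkCircle k E}
    (hJ : ∀ x ∈ V, ∀ φ, J x φ = F x φ) : ContinuousOn J V := by
  intro x hx
  rw [ContinuousWithinAt, Metric.tendsto_nhds]
  intro ε hε
  have key : ∀ j : Fin (k + 1), ∀ᶠ y in 𝓝[V] x, ∀ φ ∈ Icc 0 (2 * π),
      dist (iteratedDeriv j (F y) φ) (iteratedDeriv j (F x) φ) < ε / 2 := by
    intro j
    have hc : ContinuousOn (Function.uncurry fun x φ => iteratedDeriv j (F x) φ)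
        (V ×ˢ Icc 0 (2 * π)) := by
      refine ContinuousOn.mono (ContDiffOn.continuousOn (n := (0 : ℕ))
        (contDiffOn_uncurry_iteratedDeriv hV j (hF.of_le ?_))) (prod_mono le_rfl (subset_univ _))
      exact_mod_cast Nat.lt_succ_iff.mp j.2
    obtain ⟨v, hv, h⟩ := isCompact_Icc.mem_uniformity_of_prod hc hx
      (Metric.dist_mem_uniformity (half_pos hε))
    filter_upwards [hv] with y hy φ hφ using h y hy φ hφ
  filter_upwards [Filter.eventually_all.2 key, self_mem_nhdsWithin] with y hy hyV
  have hFJ : ∀ z ∈ V, F z = J z := fun z hz => funext fun φ => (hJ z hz φ).symm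
  rw [hFJ x hx, hFJ y hyV] at hy
  rw [dist_eq_norm]
  refine lt_of_le_of_lt (CkCircle.norm_le_of_iteratedDeriv_le _ (half_pos hε).le
    fun j hj φ => ?_) (half_lt_self hε)
  obtain ⟨ψ, hψ, h⟩ := ((J y - J x).periodic_iteratedDeriv j).exists_mem_Ico₀
    (by positivity) φ
  rw [h]
  have := (hy ⟨j, Nat.lt_succ_of_le hj⟩ ψ (Ico_subset_Icc_self hψ)).le
  rw [dist_eq_norm] at this
  have e := (CkCircle.evJet hj ψ).map_sub (J y) (J x)
  simp only [CkCircle.evJet_apply] at e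
  rwa [e]

/-- **Exponential law.** A family `x ↦ F x` of periodic functions which is jointly of class
`C^(k+ℓ)` defines a map of class `C^ℓ` into `C^k(S¹; E)`. -/
theorem contDiffOn_ckCircle_of_uncurry {k : ℕ} (ℓ : ℕ) (hV : IsOpen V) [CompleteSpace E]
    (hF : ContDiffOn ℝ (k + ℓ : ℕ) (Function.uncurry F) (V ×ˢ univ)) {J : X → CkCircle k E}
    (hJ : ∀ x ∈ V, ∀ φ, J x φ = F x φ) : ContDiffOn ℝ ℓ J V := by
  -- The derivative in `x` is a family with values in `X →L[ℝ] E`, and the induction hypothesis is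
  -- applied to it. Hence `E` must vary, and `X` and `E` share a universe.
  induction ℓ generalizing E with
  | zero => exact contDiffOn_zero.2 (continuousOn_ckCircle_of_uncurry hV hF hJ)
  | succ ℓ ih =>
    have hne : ((k + (ℓ + 1) : ℕ) : WithTop ℕ∞) ≠ 0 := by
      exact_mod_cast (by omega : k + (ℓ + 1) ≠ 0)
    let F' : X → ℝ → (X →L[ℝ] E) := fun x φ =>
      fderiv ℝ (Function.uncurry F) (x, φ) ∘L ContinuousLinearMap.inl ℝ X ℝ
    have hF'd : ∀ x ∈ V, ∀ φ, HasFDerivAt (fun x => F x φ) (F' x φ) x := fun x hx φ =>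
      hasFDerivAt_of_contDiffOn_uncurry hne hV hF hx φ
    have hF' : ContDiffOn ℝ (k + ℓ : ℕ) (Function.uncurry F') (V ×ˢ univ) :=
      (hF.fderiv_of_isOpen (hV.prod isOpen_univ)
        (by exact_mod_cast (by omega : k + ℓ + 1 ≤ k + (ℓ + 1)))).clm_comp contDiffOn_const
    have hF'k : ∀ x ∈ V, ContDiff ℝ k (F' x) := fun x hx =>
      (contDiff_of_contDiffOn_uncurry hF' hx).of_le (by exact_mod_cast Nat.le_add_right k ℓ)
    have hF'p : ∀ x ∈ V, Function.Periodic (F' x) (2 * π) := by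
      intro x hx φ
      -- The families `y ↦ F y φ` and `y ↦ F y (φ + 2 * π)` agree near `x`, so their derivatives
      -- agree.
      refine (hF'd x hx (φ + 2 * π)).unique ((hF'd x hx φ).congr_of_eventuallyEq ?_)
      filter_upwards [hV.mem_nhds hx] with y hy
      rw [← hJ y hy, ← hJ y hy, (J y).periodic φ]
    classical
    let J' : X → CkCircle k (X →L[ℝ] E) := fun x =>
      if hx : x ∈ V then .ofPeriodic (F' x) (hF'p x hx) (hF'k x hx) else 0
    have hJ' : ∀ x ∈ V, ∀ φ, J' x φ = F' x φ := fun x hx φ => by simp [J', hx]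
    have hJ'c : ContDiffOn ℝ ℓ J' V := ih hF' hJ'
    let A : X → X →L[ℝ] CkCircle k E := fun x => CkCircle.applyCLM X E k (J' x)
    have hA : ContDiffOn ℝ ℓ A V := (CkCircle.applyCLM X E k).contDiff.comp_contDiffOn hJ'c
    -- `J (x + h) - J x` is the integral of `A (x + t • h) h` over `[0, 1]`, an identity checked by
    -- evaluating at every `φ`. Continuity of `A` then gives the Fréchet derivative.
    have hd : ∀ x ∈ V, HasFDerivAt J (A x) x := by
      intro x hx
      rw [hasFDerivAt_iff_isLittleO_nhds_zero, Asymptotics.isLittleO_iff]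
      intro c hc
      have hAx : ContinuousAt A x := hA.continuousOn.continuousAt (hV.mem_nhds hx)
      obtain ⟨ρ, hρ, hball⟩ := Metric.mem_nhds_iff.1 (Filter.inter_mem (hV.mem_nhds hx)
        (hAx.preimage_mem_nhds (Metric.closedBall_mem_nhds _ hc)))
      filter_upwards [Metric.ball_mem_nhds (0 : X) hρ] with h hh
      have hseg : ∀ t ∈ Icc (0 : ℝ) 1, x + t • h ∈ Metric.ball x ρ := by
        intro t ht
        rw [mem_ball_zero_iff] at hh
        rw [mem_ball_iff_norm, add_sub_cancel_left, norm_smul, Real.norm_eq_abs,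
          abs_of_nonneg ht.1]
        nlinarith [ht.2, norm_nonneg h]
      have hline : Continuous fun t : ℝ => x + t • h := by fun_prop
      have hcont : ContinuousOn (fun t : ℝ => A (x + t • h) h) (Icc 0 1) :=
        (hA.continuousOn.comp hline.continuousOn fun t ht => (hball (hseg t ht)).1).clm_apply
          continuousOn_const
      have hint : IntervalIntegrable (fun t : ℝ => A (x + t • h) h) volume 0 1 :=
        ContinuousOn.intervalIntegrable (by rwa [uIcc_of_le zero_le_one])
      have hftc : J (x + h) - J x = ∫ t in (0 : ℝ)..1, A (x + t • h) h := by
        refine CkCircle.ext fun φ => ?_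
        have hφ := (CkCircle.evJet (E := E) (Nat.zero_le k) φ).intervalIntegral_comp_comm hint
        simp only [CkCircle.evJet_zero_apply] at hφ
        have hder : ∀ t ∈ uIcc (0 : ℝ) 1,
            HasDerivAt (fun t : ℝ => F (x + t • h) φ) (A (x + t • h) h φ) t := by
          intro t ht
          rw [uIcc_of_le zero_le_one] at ht
          have hxt := (hball (hseg t ht)).1
          have h1 : HasDerivAt (fun t : ℝ => x + t • h) h t := by
            simpa using ((hasDerivAt_id t).smul_const h).const_add x
          have h2 := (hF'd _ hxt φ).comp_hasDerivAt t h1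
          rwa [← hJ' _ hxt φ] at h2
        have hint' : IntervalIntegrable (fun t : ℝ => A (x + t • h) h φ) volume 0 1 := by
          refine ContinuousOn.intervalIntegrable ?_
          rw [uIcc_of_le zero_le_one]
          refine ((CkCircle.evJet (E := E) (Nat.zero_le k) φ).continuous.comp_continuousOn
            hcont).congr fun t _ => ?_
          exact (CkCircle.evJet_zero_apply φ _).symm
        rw [← hφ, intervalIntegral.integral_eq_sub_of_hasDerivAt hder hint', CkCircle.sub_apply,
          one_smul, zero_smul, add_zero, hJ _ hx,
          hJ _ (by simpa using (hball (hseg 1 ⟨zero_le_one, le_rfl⟩)).1)]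
      have hconst : A x h = ∫ _t in (0 : ℝ)..1, A x h := by simp
      rw [hftc, hconst, ← intervalIntegral.integral_sub hint intervalIntegrable_const]
      have := intervalIntegral.norm_integral_le_of_norm_le_const (a := (0 : ℝ)) (b := 1)
        (C := c * ‖h‖) (f := fun t : ℝ => A (x + t • h) h - A x h) fun t ht => by
          rw [uIoc_of_le zero_le_one] at ht
          have h1 := (hball (hseg t ⟨ht.1.le, ht.2⟩)).2
          rw [mem_preimage, mem_closedBall_iff_norm] at h1
          exact ((A (x + t • h) - A x).le_opNorm h).trans
            (mul_le_mul_of_nonneg_right h1 (norm_nonneg h))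
      simpa using this
    push_cast
    rw [contDiffOn_succ_iff_fderiv_of_isOpen hV]
    exact ⟨fun x hx => (hd x hx).differentiableAt.differentiableWithinAt, by simp,
      hA.congr fun x hx => (hd x hx).fderiv⟩

end ExponentialLaw

/-! ### Plane determinants and the geometric conditions on the curve. -/

/-- The determinant of two plane vectors. -/
def cross (v w : Plane) : ℝ := v 0 * w 1 - v 1 * w 0

theorem inner_eq (v w : Plane) : ⟪v, w⟫ = v 0 * w 0 + v 1 * w 1 := by
  simp [PiLp.inner_apply, Fin.sum_univ_two]
  ring

theorem inner_perp (v w : Plane) : ⟪v, perp w⟫ = cross v w := by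
  simp only [inner_eq, perp, cross, Matrix.cons_val_zero, Matrix.cons_val_one]
  ring

theorem inner_perp_sub_perp (u v w : Plane) : ⟪u, perp v - perp w⟫ = cross u v - cross u w := by
  rw [inner_sub_right, inner_perp, inner_perp]

theorem norm_sq_eq (v : Plane) : ‖v‖ ^ 2 = v 0 ^ 2 + v 1 ^ 2 := by
  rw [← real_inner_self_eq_norm_sq, inner_eq]
  ring

theorem cross_sq_add_inner_sq (v w : Plane) : cross v w ^ 2 + ⟪v, w⟫ ^ 2 = ‖v‖ ^ 2 * ‖w‖ ^ 2 := by
  rw [norm_sq_eq, norm_sq_eq, inner_eq, cross]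
  ring

theorem abs_cross_le (v w : Plane) : |cross v w| ≤ ‖v‖ * ‖w‖ := by
  refine abs_le_of_sq_le_sq ?_ (by positivity)
  nlinarith [cross_sq_add_inner_sq v w, sq_nonneg ⟪v, w⟫]

theorem cross_add_left (u v w : Plane) : cross (u + v) w = cross u w + cross v w := by
  simp [cross]; ring

theorem cross_add_right (u v w : Plane) : cross u (v + w) = cross u v + cross u w := by
  simp [cross]; ring

theorem cross_sub_left (u v w : Plane) : cross (u - v) w = cross u w - cross v w := by
  simp [cross]; ring

theorem cross_sub_right (u v w : Plane) : cross u (v - w) = cross u v - cross u w := by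
  simp [cross]; ring

theorem cross_smul_left (a : ℝ) (v w : Plane) : cross (a • v) w = a * cross v w := by
  simp [cross]; ring

theorem cross_smul_right (a : ℝ) (v w : Plane) : cross v (a • w) = a * cross v w := by
  simp [cross]; ring

theorem cross_self (v : Plane) : cross v v = 0 := by
  simp [cross]; ring

theorem cross_swap (v w : Plane) : cross v w = -cross w v := by
  simp [cross]; ring

/-- A closed curve which shares with the circle those features that matter for its intersections
with the circles of radius `r` around its points: it lies strictly to the left of each of its
tangents, the distance from `γ φ` is strictly monotone as long as the parameter distance from `φ`
is at most `x₁`, and exceeds `r` beyond. -/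
structure NearCircle (r x₁ : ℝ) (γ : ℝ → Plane) : Prop where
  r_pos : 0 < r
  pos : 0 < x₁
  lt_pi : x₁ < π
  periodic : Function.Periodic γ (2 * π)
  contDiff : ContDiff ℝ 1 γ
  left_of_tangent : ∀ φ x, 0 < x → x < 2 * π → 0 < cross (deriv γ φ) (γ (φ + x) - γ φ)
  inner_pos : ∀ φ x, 0 < x → x ≤ x₁ → 0 < ⟪deriv γ (φ + x), γ (φ + x) - γ φ⟫
  inner_neg : ∀ φ x, -x₁ ≤ x → x < 0 → ⟪deriv γ (φ + x), γ (φ + x) - γ φ⟫ < 0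
  lt_dist : ∀ φ x, x₁ ≤ x → x ≤ 2 * π - x₁ → r < dist (γ (φ + x)) (γ φ)

/-! ### Stability of these conditions near the circle. -/

section Neighbourhood

theorem deriv_circleCurve (n : ℕ) (R φ : ℝ) :
    deriv (circleCurve n R) φ = !₂[-(R * Real.sin φ), R * Real.cos φ] := by
  have h : HasDerivAt (fun φ => ![R * Real.cos φ, R * Real.sin φ])
      ![-(R * Real.sin φ), R * Real.cos φ] φ := by
    refine hasDerivAt_pi.2 fun i => ?_
    fin_cases i
    · simpa using (Real.hasDerivAt_cos φ).const_mul R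
    · simpa using (Real.hasDerivAt_sin φ).const_mul R
  exact ((EuclideanSpace.equiv (Fin 2) ℝ).symm.hasFDerivAt.comp_hasDerivAt φ h).deriv

theorem circleCurve_apply_zero (n : ℕ) (R φ : ℝ) : circleCurve n R φ 0 = R * Real.cos φ := rfl

theorem circleCurve_apply_one (n : ℕ) (R φ : ℝ) : circleCurve n R φ 1 = R * Real.sin φ := rfl

theorem cross_deriv_circleCurve (n : ℕ) (R φ x : ℝ) :
    cross (deriv (circleCurve n R) φ) (circleCurve n R (φ + x) - circleCurve n R φ)
      = R ^ 2 * (1 - Real.cos x) := by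
  simp only [deriv_circleCurve, cross, PiLp.sub_apply, circleCurve_apply_zero,
    circleCurve_apply_one, PiLp.toLp_apply, Matrix.cons_val_zero, Matrix.cons_val_one,
    Real.cos_add, Real.sin_add]
  linear_combination (R ^ 2 - R ^ 2 * Real.cos x) * Real.sin_sq_add_cos_sq φ

theorem inner_deriv_circleCurve (n : ℕ) (R φ x : ℝ) :
    ⟪deriv (circleCurve n R) (φ + x), circleCurve n R (φ + x) - circleCurve n R φ⟫
      = R ^ 2 * Real.sin x := by
  simp only [deriv_circleCurve, inner_eq, PiLp.sub_apply, circleCurve_apply_zero,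
    circleCurve_apply_one, Matrix.cons_val_zero, Matrix.cons_val_one,
    Real.cos_add, Real.sin_add]
  linear_combination (R ^ 2 * Real.sin x) * Real.sin_sq_add_cos_sq φ

theorem norm_circleCurve_sub_sq (n : ℕ) (R φ x : ℝ) :
    ‖circleCurve n R (φ + x) - circleCurve n R φ‖ ^ 2 = (2 * R * Real.sin (x / 2)) ^ 2 := by
  have h1 : Real.sin (x / 2) ^ 2 = 1 / 2 - Real.cos x / 2 := by
    rw [Real.sin_sq_eq_half_sub, mul_div_cancel₀ _ two_ne_zero]
  rw [norm_sq_eq, mul_pow, h1]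
  simp only [PiLp.sub_apply, circleCurve_apply_zero,
    circleCurve_apply_one, Real.cos_add, Real.sin_add]
  linear_combination (R ^ 2 * (Real.sin x ^ 2 + Real.cos x ^ 2) - 2 * R ^ 2 * Real.cos x + R ^ 2) *
    Real.sin_sq_add_cos_sq φ + R ^ 2 * Real.sin_sq_add_cos_sq x

/-- Jordan's inequality at `|y| / 2`, squared. Being quadratic over a full period, the bound can
absorb the quadratic errors of a perturbation, even near `y = 0`. -/
theorem two_mul_div_pi_sq_le_one_sub_cos {y : ℝ} (hy : |y| ≤ π) :
    2 / π ^ 2 * y ^ 2 ≤ 1 - Real.cos y := by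
  have h := Real.mul_le_sin (x := |y| / 2) (by positivity) (by linarith)
  have h1 : Real.sin (|y| / 2) ^ 2 = 1 / 2 - Real.cos y / 2 := by
    rw [Real.sin_sq_eq_half_sub, mul_div_cancel₀ _ two_ne_zero, Real.cos_abs]
  have h2 : (2 / π * (|y| / 2)) ^ 2 ≤ Real.sin (|y| / 2) ^ 2 := by gcongr
  have h3 : (2 / π * (|y| / 2)) ^ 2 = y ^ 2 / π ^ 2 := by
    rw [← sq_abs y]
    field_simp
  rw [h1, h3] at h2
  have h4 : 2 / π ^ 2 * y ^ 2 = 2 * (y ^ 2 / π ^ 2) := by ring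
  linarith

/-- Double angle formula, with Jordan's inequality for the sine and monotonicity for the cosine. The
constant degenerates as `x₁` tends to `π`. -/
theorem mul_sin_ge {x₁ y : ℝ} (hx : x₁ < π) (hy : |y| ≤ x₁) :
    2 / π * Real.cos (x₁ / 2) * y ^ 2 ≤ y * Real.sin y := by
  have h := Real.mul_le_sin (x := |y| / 2) (by positivity) (by linarith)
  have hc : Real.cos (x₁ / 2) ≤ Real.cos (|y| / 2) :=
    Real.cos_le_cos_of_nonneg_of_le_pi (by positivity) (by linarith [abs_nonneg y]) (by linarith)
  have hc0 : 0 ≤ Real.cos (x₁ / 2) :=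
    Real.cos_nonneg_of_neg_pi_div_two_le_of_le (by linarith [abs_nonneg y, Real.pi_pos])
      (by linarith)
  have h1 : y * Real.sin y = |y| * Real.sin |y| := by
    rcases abs_choice y with h | h <;> rw [h]
    rw [Real.sin_neg]; ring
  have h2 : Real.sin |y| = 2 * Real.sin (|y| / 2) * Real.cos (|y| / 2) := by
    rw [← Real.sin_two_mul, mul_div_cancel₀ _ two_ne_zero]
  have h3 : (2 / π * (|y| / 2)) * Real.cos (x₁ / 2) ≤ Real.sin (|y| / 2) * Real.cos (|y| / 2) :=
    mul_le_mul h hc hc0 (le_trans (by positivity) h)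
  rw [h1, h2, ← sq_abs y]
  nlinarith [mul_le_mul_of_nonneg_left h3 (abs_nonneg y)]

/-- This is where `r / 2 < R` enters: the diameter `2 * R` exceeds `r`, hence so do chords of
parameter length close to `π`. -/
theorem exists_sin_half_gt {r R : ℝ} (hR : r / 2 < R) :
    ∃ x₁, 0 < x₁ ∧ x₁ < π ∧ r < 2 * R * Real.sin (x₁ / 2) := by
  have hc : Filter.Tendsto (fun x => 2 * R * Real.sin (x / 2)) (𝓝[<] π) (𝓝 (2 * R)) := by
    have : Continuous fun x => 2 * R * Real.sin (x / 2) := by fun_prop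
    exact (this.tendsto' π (2 * R) (by simp)).mono_left nhdsWithin_le_nhds
  have h := (hc.eventually_const_lt (show r < 2 * R by linarith)).and
    (Ioo_mem_nhdsLT Real.pi_pos)
  obtain ⟨x, h1, h2⟩ := h.exists
  exact ⟨x, h2.1, h2.2, h1⟩

variable {n : ℕ}

theorem CkCircle.deriv_add (hn : 1 ≤ n) (f g : CkCircle n Plane) (φ : ℝ) :
    deriv (f + g) φ = deriv f φ + deriv g φ := by
  simpa only [evJet_one_apply] using (evJet hn φ).map_add f g

theorem CkCircle.norm_deriv_le (hn : 1 ≤ n) (f : CkCircle n Plane) (φ : ℝ) :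
    ‖deriv f φ‖ ≤ ‖f‖ := by
  simpa only [iteratedDeriv_one] using f.norm_iteratedDeriv_le hn φ

theorem CkCircle.norm_add_sub_le (hn : 1 ≤ n) (f : CkCircle n Plane) (φ x : ℝ) :
    ‖f (φ + x) - f φ‖ ≤ ‖f‖ * |x| := by
  simpa only [iteratedDeriv_zero, add_sub_cancel_left] using
    f.norm_iteratedDeriv_sub_le (j := 0) hn φ (φ + x)

theorem CkCircle.norm_taylor_le (hn : 2 ≤ n) (f : CkCircle n Plane) (φ x : ℝ) :
    ‖f (φ + x) - f φ - x • deriv f φ‖ ≤ ‖f‖ * x ^ 2 := by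
  have := f.norm_iteratedDeriv_taylor_le (j := 0) hn φ (φ + x)
  rw [mul_assoc, abs_mul_abs_self] at this
  simpa only [iteratedDeriv_zero, zero_add, iteratedDeriv_one, add_sub_cancel_left, ← sq] using this

/-- The main term is only of order `y ^ 2`, so linear errors would be fatal. They cancel: the
contributions of `y • deriv δ φ` and `y • deriv c φ` are opposite by antisymmetry, and the terms
left are Taylor remainders. -/
theorem cross_perturb_pos (hn : 2 ≤ n) {R ε : ℝ} (δ : CkCircle n Plane) (hδ : ‖δ‖ ≤ ε)
    (hε : 2 * ‖circleCurve n R‖ * ε + ε ^ 2 < R ^ 2 * (2 / π ^ 2)) (φ : ℝ) {y : ℝ} (hy : |y| ≤ π)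
    (hy0 : y ≠ 0) :
    0 < cross (deriv (circleCurve n R + δ) φ)
      ((circleCurve n R + δ) (φ + y) - (circleCurve n R + δ) φ) := by
  have hε0 : 0 ≤ ε := (norm_nonneg _).trans hδ
  have hmain := cross_deriv_circleCurve n R φ y
  set c := circleCurve n R
  set ec := c (φ + y) - c φ - y • deriv c φ with hec
  set ed := δ (φ + y) - δ φ - y • deriv δ φ with hed
  have hexp : cross (deriv (c + δ) φ) ((c + δ) (φ + y) - (c + δ) φ) =
      cross (deriv c φ) (c (φ + y) - c φ) + cross (deriv c φ) ed + cross (deriv δ φ) ec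
        + cross (deriv δ φ) ed := by
    rw [CkCircle.deriv_add (by omega), hec, hed]
    simp only [CkCircle.add_apply, cross_add_left, cross_add_right, cross_sub_right,
      cross_smul_right, cross_self]
    rw [cross_swap (deriv δ φ) (deriv c φ)]
    ring
  have h1 : |cross (deriv c φ) ed| ≤ ‖c‖ * (ε * y ^ 2) := (abs_cross_le _ _).trans
    (mul_le_mul (c.norm_deriv_le (by omega) φ) ((δ.norm_taylor_le hn φ y).trans (by gcongr))
      (norm_nonneg _) (norm_nonneg _))
  have h2 : |cross (deriv δ φ) ec| ≤ ε * (‖c‖ * y ^ 2) := (abs_cross_le _ _).trans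
    (mul_le_mul ((δ.norm_deriv_le (by omega) φ).trans hδ) (c.norm_taylor_le hn φ y)
      (norm_nonneg _) hε0)
  have h3 : |cross (deriv δ φ) ed| ≤ ε * (ε * y ^ 2) := (abs_cross_le _ _).trans
    (mul_le_mul ((δ.norm_deriv_le (by omega) φ).trans hδ)
      ((δ.norm_taylor_le hn φ y).trans (by gcongr)) (norm_nonneg _) hε0)
  have h4 := mul_le_mul_of_nonneg_left (two_mul_div_pi_sq_le_one_sub_cos hy) (sq_nonneg R)
  have h5 := mul_lt_mul_of_pos_right hε (sq_pos_of_ne_zero hy0)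
  rw [hexp, hmain]
  linarith [neg_abs_le (cross (deriv c φ) ed), neg_abs_le (cross (deriv δ φ) ec),
    neg_abs_le (cross (deriv δ φ) ed)]

/-- Here the main term `R ^ 2 * sin y` is linear near `0`, so Lipschitz bounds suffice. The factor
`y` treats both signs at once. -/
theorem mul_inner_perturb_pos (hn : 2 ≤ n) {R ε x₁ : ℝ} (δ : CkCircle n Plane) (hδ : ‖δ‖ ≤ ε)
    (hx : x₁ < π)
    (hε : 2 * ‖circleCurve n R‖ * ε + ε ^ 2 < R ^ 2 * (2 / π * Real.cos (x₁ / 2))) (φ : ℝ) {y : ℝ}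
    (hy : |y| ≤ x₁) (hy0 : y ≠ 0) :
    0 < y * ⟪deriv (circleCurve n R + δ) (φ + y),
      (circleCurve n R + δ) (φ + y) - (circleCurve n R + δ) φ⟫ := by
  have hε0 : 0 ≤ ε := (norm_nonneg _).trans hδ
  have hmain := inner_deriv_circleCurve n R φ y
  set c := circleCurve n R
  have hexp : ⟪deriv (c + δ) (φ + y), (c + δ) (φ + y) - (c + δ) φ⟫ =
      ⟪deriv c (φ + y), c (φ + y) - c φ⟫ + ⟪deriv c (φ + y), δ (φ + y) - δ φ⟫
        + ⟪deriv δ (φ + y), c (φ + y) - c φ⟫ + ⟪deriv δ (φ + y), δ (φ + y) - δ φ⟫ := by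
    rw [CkCircle.deriv_add (by omega)]
    simp only [CkCircle.add_apply, inner_add_left, inner_add_right, inner_sub_right]
    ring
  set e := ⟪deriv c (φ + y), δ (φ + y) - δ φ⟫ + ⟪deriv δ (φ + y), c (φ + y) - c φ⟫
    + ⟪deriv δ (φ + y), δ (φ + y) - δ φ⟫ with he
  have h1 : |⟪deriv c (φ + y), δ (φ + y) - δ φ⟫| ≤ ‖c‖ * (ε * |y|) :=
    (abs_real_inner_le_norm _ _).trans
      (mul_le_mul (c.norm_deriv_le (by omega) _)
        ((δ.norm_add_sub_le (by omega) φ y).trans (by gcongr)) (norm_nonneg _) (norm_nonneg _))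
  have h2 : |⟪deriv δ (φ + y), c (φ + y) - c φ⟫| ≤ ε * (‖c‖ * |y|) :=
    (abs_real_inner_le_norm _ _).trans
      (mul_le_mul ((δ.norm_deriv_le (by omega) _).trans hδ) (c.norm_add_sub_le (by omega) φ y)
        (norm_nonneg _) hε0)
  have h3 : |⟪deriv δ (φ + y), δ (φ + y) - δ φ⟫| ≤ ε * (ε * |y|) :=
    (abs_real_inner_le_norm _ _).trans
      (mul_le_mul ((δ.norm_deriv_le (by omega) _).trans hδ)
        ((δ.norm_add_sub_le (by omega) φ y).trans (by gcongr)) (norm_nonneg _) hε0)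
  have he' : |e| ≤ (2 * ‖c‖ * ε + ε ^ 2) * |y| :=
    ((abs_add_three _ _ _).trans (add_le_add (add_le_add h1 h2) h3)).trans (by linarith)
  have h4 := mul_le_mul_of_nonneg_left (mul_sin_ge hx hy) (sq_nonneg R)
  have h5 := mul_lt_mul_of_pos_right hε (sq_pos_of_ne_zero hy0)
  have h6 : -(y * e) ≤ (2 * ‖c‖ * ε + ε ^ 2) * y ^ 2 := by
    have := mul_le_mul_of_nonneg_left he' (abs_nonneg y)
    rw [← abs_mul] at this
    calc -(y * e) ≤ |y * e| := neg_le_abs _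
      _ ≤ _ := this
      _ = (2 * ‖c‖ * ε + ε ^ 2) * (|y| * |y|) := by ring
      _ = _ := by rw [abs_mul_abs_self]; ring
  have h7 : ⟪deriv (c + δ) (φ + y), (c + δ) (φ + y) - (c + δ) φ⟫ = R ^ 2 * Real.sin y + e := by
    rw [hexp, hmain, he]; ring
  rw [h7]
  linarith

/-- The chord of the circle has length `2 * R * sin (y / 2)`, which is least at the ends of `[x₁, 2
* π - x₁]`; the perturbation changes it by at most `2 * ε`. -/
theorem lt_dist_perturb {R r ε x₁ : ℝ} (hR : 0 < R) (δ : CkCircle n Plane)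
    (hδ : ‖δ‖ ≤ ε) (hx0 : 0 < x₁) (hx : x₁ < π) (hε : r + 2 * ε < 2 * R * Real.sin (x₁ / 2))
    (φ : ℝ) {y : ℝ} (hy : x₁ ≤ y) (hy' : y ≤ 2 * π - x₁) :
    r < dist ((circleCurve n R + δ) (φ + y)) ((circleCurve n R + δ) φ) := by
  set c := circleCurve n R with hc
  have hs : Real.sin (x₁ / 2) ≤ Real.sin (y / 2) := by
    rcases le_total y π with h | h
    · exact Real.sin_le_sin_of_le_of_le_pi_div_two (by linarith) (by linarith) (by linarith)
    · rw [← Real.sin_pi_sub (y / 2)]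
      exact Real.sin_le_sin_of_le_of_le_pi_div_two (by linarith) (by linarith) (by linarith)
  have hs0 : 0 ≤ Real.sin (x₁ / 2) :=
    Real.sin_nonneg_of_nonneg_of_le_pi (by linarith) (by linarith)
  have h1 : ‖c (φ + y) - c φ‖ = 2 * R * Real.sin (y / 2) := by
    rw [← abs_of_nonneg (norm_nonneg (c (φ + y) - c φ)),
      ← abs_of_nonneg (show 0 ≤ 2 * R * Real.sin (y / 2) by
        have := hs0.trans hs; positivity)]
    exact (sq_eq_sq_iff_abs_eq_abs _ _).1 (norm_circleCurve_sub_sq n R φ y)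
  have h2 : ‖δ (φ + y) - δ φ‖ ≤ 2 * ε := by
    have h3 : ∀ ψ, ‖δ ψ‖ ≤ ε := fun ψ => by
      simpa only [iteratedDeriv_zero] using (δ.norm_iteratedDeriv_le (Nat.zero_le n) ψ).trans hδ
    linarith [norm_sub_le (δ (φ + y)) (δ φ), h3 (φ + y), h3 φ]
  have h3 : (c + δ) (φ + y) - (c + δ) φ = (c (φ + y) - c φ) + (δ (φ + y) - δ φ) := by
    simp only [CkCircle.add_apply]; abel
  rw [dist_eq_norm, h3]
  have h4 : ‖c (φ + y) - c φ‖ - ‖δ (φ + y) - δ φ‖ ≤ _ := norm_sub_le_norm_add _ _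
  have h5 : 2 * R * Real.sin (x₁ / 2) ≤ 2 * R * Real.sin (y / 2) := by gcongr
  linarith

/-- Curves that are `C²`-close to the circle are `NearCircle`. -/
theorem exists_nearCircle (hn : 2 ≤ n) {r R : ℝ} (hr : 0 < r) (hR : r / 2 < R) :
    ∃ x₁ ε : ℝ, 0 < ε ∧ ∀ γ ∈ Metric.ball (circleCurve n R) ε, NearCircle r x₁ γ := by
  have hR0 : 0 < R := by linarith
  obtain ⟨x₁, hx0, hx, hs⟩ := exists_sin_half_gt hR
  have hcos : 0 < Real.cos (x₁ / 2) :=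
    Real.cos_pos_of_mem_Ioo ⟨by linarith [Real.pi_pos], by linarith⟩
  have hev : ∀ᶠ ε : ℝ in 𝓝[>] 0, 2 * ‖circleCurve n R‖ * ε + ε ^ 2 < R ^ 2 * (2 / π ^ 2) ∧
      2 * ‖circleCurve n R‖ * ε + ε ^ 2 < R ^ 2 * (2 / π * Real.cos (x₁ / 2)) ∧
      r + 2 * ε < 2 * R * Real.sin (x₁ / 2) := by
    refine Filter.Eventually.filter_mono nhdsWithin_le_nhds ?_
    have hc : Continuous fun ε : ℝ => 2 * ‖circleCurve n R‖ * ε + ε ^ 2 := by fun_prop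
    have hc' : Continuous fun ε : ℝ => r + 2 * ε := by fun_prop
    exact ((hc.tendsto' 0 0 (by simp)).eventually_lt_const (by positivity)).and
      (((hc.tendsto' 0 0 (by simp)).eventually_lt_const (by positivity)).and
      ((hc'.tendsto' 0 r (by simp)).eventually_lt_const hs))
  obtain ⟨ε, ⟨h1, h2, h3⟩, hε⟩ := (hev.and self_mem_nhdsWithin).exists
  refine ⟨x₁, ε, hε, fun γ hγ => ?_⟩
  obtain ⟨δ, rfl⟩ : ∃ δ, γ = circleCurve n R + δ := ⟨γ - circleCurve n R, by abel⟩
  have hδ : ‖δ‖ ≤ ε := by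
    rw [mem_ball_iff_norm, add_sub_cancel_left] at hγ
    exact hγ.le
  refine ⟨hr, hx0, hx, CkCircle.periodic _,
    (CkCircle.contDiff _).of_le (by exact_mod_cast (by omega : 1 ≤ n)), ?_, ?_, ?_, ?_⟩
  · intro φ x hx0 hx2
    rcases le_or_gt x π with h | h
    · exact cross_perturb_pos hn δ hδ h1 φ (by rwa [abs_of_pos hx0]) hx0.ne'
    -- The estimate covers `|y| ≤ π`; longer arcs are reached backwards by periodicity.
    · have := cross_perturb_pos hn δ hδ h1 φ (y := x - 2 * π)
        (by rw [abs_le]; constructor <;> linarith) (by linarith)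
      rwa [← add_sub_assoc, (CkCircle.periodic (circleCurve n R + δ)).sub_eq] at this
  · intro φ x h hx'
    exact (mul_pos_iff_of_pos_left h).1
      (mul_inner_perturb_pos hn δ hδ hx h2 φ (by rwa [abs_of_pos h]) h.ne')
  · intro φ x hx' h
    exact (neg_iff_neg_of_mul_pos (mul_inner_perturb_pos hn δ hδ hx h2 φ
      (abs_le.2 ⟨hx', by linarith⟩) h.ne)).1 h
  · exact fun φ x h h' => lt_dist_perturb hR0 δ hδ hx0 hx h3 φ h h'

end Neighbourhood

/-! ### Intersections with the circle of radius `r`, and orientation of chords. -/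

theorem exists_crossing {g : ℝ → ℝ} {r x₁ : ℝ} (hx : 0 < x₁) (hc : ContinuousOn g (Icc 0 x₁))
    (hm : StrictMonoOn g (Icc 0 x₁)) (h0 : g 0 < r) (h1 : r < g x₁) :
    ∃ x ∈ Ioo 0 x₁, g x = r ∧ (∀ y ∈ Ico 0 x, g y < r) ∧ ∀ y ∈ Ioc x x₁, r < g y := by
  obtain ⟨x, hxm, hxr⟩ := intermediate_value_Ioo hx.le hc ⟨h0, h1⟩
  have hxI := Ioo_subset_Icc_self hxm
  refine ⟨x, hxm, hxr, fun y hy => ?_, fun y hy => ?_⟩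
  · rw [← hxr]
    exact hm ⟨hy.1, hy.2.le.trans hxI.2⟩ hxI hy.2
  · rw [← hxr]
    exact hm hxI ⟨hxI.1.trans hy.1.le, hy.2⟩ hy.1

namespace NearCircle

variable {r x₁ : ℝ} {γ : ℝ → Plane} (h : NearCircle r x₁ γ)

include h

theorem hasDerivAt (φ : ℝ) : HasDerivAt γ (deriv γ φ) φ :=
  (h.contDiff.differentiable one_ne_zero φ).hasDerivAt

theorem continuous_deriv : Continuous (deriv γ) := h.contDiff.continuous_deriv le_rfl

theorem continuous : Continuous γ := h.contDiff.continuous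

theorem deriv_add_two_pi (φ : ℝ) : deriv γ (φ + 2 * π) = deriv γ φ := by
  rw [← deriv_comp_add_const]
  congr 1
  exact funext h.periodic

theorem cross_left_pos {a b : ℝ} (hab : a < b) (hb : b < a + 2 * π) :
    0 < cross (deriv γ a) (γ b - γ a) := by
  simpa using h.left_of_tangent a (b - a) (by linarith) (by linarith)

theorem cross_right_pos {a b : ℝ} (hab : a < b) (hb : b < a + 2 * π) :
    0 < cross (deriv γ b) (γ a - γ b) := by
  have := h.left_of_tangent b (a + 2 * π - b) (by linarith) (by linarith)
  rwa [add_sub_cancel, h.periodic] at this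

theorem isEmbedded : IsEmbedded γ := by
  intro x hx y hy hxy
  by_contra hne
  wlog hlt : x < y generalizing x y
  · exact this hy hx hxy.symm (Ne.symm hne) (lt_of_le_of_ne (not_lt.1 hlt) (Ne.symm hne))
  have := h.cross_left_pos hlt (by linarith [hx.1, hy.2])
  rw [hxy, sub_self] at this
  simp [cross] at this

/-- No three points of the curve are collinear. -/
theorem cross_chords_ne_zero {a b c : ℝ} (hab : a < b) (hbc : b < c) (hc : c < a + 2 * π) :
    cross (γ b - γ a) (γ c - γ a) ≠ 0 := by
  intro h0
  have hab' := h.cross_left_pos hab (by linarith)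
  have hac' := h.cross_left_pos (hab.trans hbc) hc
  have hba := h.cross_right_pos hab (by linarith)
  have hca := h.cross_right_pos (hab.trans hbc) hc
  have hbc' := h.cross_left_pos hbc (by linarith)
  have hcb := h.cross_right_pos hbc (by linarith)
  rw [show γ c - γ b = (γ c - γ a) - (γ b - γ a) by abel] at hbc'
  rw [show γ b - γ c = (γ b - γ a) - (γ c - γ a) by abel] at hcb
  rw [← neg_sub] at hba hca
  generalize γ b - γ a = u at *
  generalize γ c - γ a = v at *
  obtain ⟨t, rfl⟩ : ∃ t : ℝ, v = t • u := by
    have hu : u 0 ≠ 0 ∨ u 1 ≠ 0 := by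
      by_contra! hu
      simp [cross, hu] at hab'
    rcases hu with hu | hu
    · refine ⟨v 0 / u 0, ?_⟩
      ext i
      fin_cases i
      · simp [hu]
      · simp only [cross] at h0
        simp only [Fin.mk_one, PiLp.smul_apply, smul_eq_mul]
        field_simp
        linarith
    · refine ⟨v 1 / u 1, ?_⟩
      ext i
      fin_cases i
      · simp only [cross] at h0
        simp only [Fin.zero_eta, PiLp.smul_apply, smul_eq_mul]
        field_simp
        linarith
      · simp [hu]
  rw [show -u = (-1 : ℝ) • u by simp, cross_smul_right] at hba
  rw [show -(t • u) = (-t) • u by simp, cross_smul_right] at hca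
  rw [cross_sub_right, cross_smul_right] at hbc' hcb
  rw [cross_smul_right] at hac'
  -- Of three collinear points the middle one would have the other two on opposite sides of its
  -- tangent, or on it. The middle point is `γ a` for `t < 0`, `γ b` for `1 < t` and `γ c` for `0 <
  -- t < 1`; coincidences fail as well.
  have ht : 0 < t := by
    by_contra! ht
    nlinarith
  rcases le_or_gt 1 t with h1 | h1 <;> nlinarith

/-- As a function of `c` the determinant vanishes at `b` with positive derivative, and it has no
zero afterwards because no three points are collinear. -/
theorem cross_chords_pos {a b c : ℝ} (hab : a < b) (hbc : b < c) (hc : c < a + 2 * π) :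
    0 < cross (γ b - γ a) (γ c - γ a) := by
  set f : ℝ → ℝ := fun t => cross (γ b - γ a) (γ t - γ a) with hf
  have hfc : Continuous f := by
    have := h.continuous
    simp only [hf, cross, PiLp.sub_apply]
    fun_prop
  have hfd : HasDerivAt f (cross (γ b - γ a) (deriv γ b)) b := by
    have h0 := hasDerivAt_pi.1 (((EuclideanSpace.equiv (Fin 2) ℝ).hasFDerivAt).comp_hasDerivAt b
      (h.hasDerivAt b))
    exact (((h0 1).sub_const (γ a 1)).const_mul ((γ b - γ a) 0)).sub
      (((h0 0).sub_const (γ a 0)).const_mul ((γ b - γ a) 1))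
  have hpos : 0 < cross (γ b - γ a) (deriv γ b) := by
    have := h.cross_right_pos hab (by linarith)
    rwa [cross_swap, ← neg_sub, show -(γ b - γ a) = (-1 : ℝ) • (γ b - γ a) by simp,
      cross_smul_left, neg_one_mul, neg_neg] at this
  have hfb : f b = 0 := cross_self _
  obtain ⟨c₀, hc₀, hc₀'⟩ : ∃ c₀ ∈ Ioo b c, 0 < f c₀ := by
    have h1 := ((hasDerivAt_iff_tendsto_slope.1 hfd).eventually_const_lt hpos).filter_mono
      (nhdsWithin_mono b (show Ioi b ⊆ {b}ᶜ from fun x hx => ne_of_gt hx))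
    obtain ⟨c₀, h2, h3⟩ := (h1.and (Ioo_mem_nhdsGT hbc)).exists
    refine ⟨c₀, h3, ?_⟩
    rw [slope_def_field, hfb, sub_zero] at h2
    exact (div_pos_iff_of_pos_right (by linarith [h3.1])).1 h2
  by_contra! hneg
  obtain ⟨z, hz, hz0⟩ := intermediate_value_Icc' hc₀.2.le hfc.continuousOn ⟨hneg, hc₀'.le⟩
  exact h.cross_chords_ne_zero hab (hc₀.1.trans_le hz.1) (by linarith [hz.2]) hz0

theorem hasDerivAt_dist_sq (φ ψ : ℝ) :
    HasDerivAt (fun ψ => ‖γ ψ - γ φ‖ ^ 2) (2 * ⟪deriv γ ψ, γ ψ - γ φ⟫) ψ := by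
  have := ((h.hasDerivAt ψ).sub_const (γ φ)).norm_sq
  rwa [real_inner_comm] at this

theorem strictMonoOn_dist_add (φ : ℝ) :
    StrictMonoOn (fun x => dist (γ (φ + x)) (γ φ)) (Icc 0 x₁) := by
  have hd : ∀ x, HasDerivAt (fun x => ‖γ (φ + x) - γ φ‖ ^ 2)
      (2 * ⟪deriv γ (φ + x), γ (φ + x) - γ φ⟫) x := fun x => by
    simpa using (h.hasDerivAt_dist_sq φ (φ + x)).comp_const_add φ x
  have hm : StrictMonoOn (fun x => ‖γ (φ + x) - γ φ‖ ^ 2) (Icc 0 x₁) := by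
    refine strictMonoOn_of_deriv_pos (convex_Icc _ _)
      (fun x _ => (hd x).continuousAt.continuousWithinAt) fun x hx => ?_
    rw [interior_Icc] at hx
    rw [(hd x).deriv]
    exact mul_pos two_pos (h.inner_pos φ x hx.1 hx.2.le)
  intro x hx y hy hxy
  simp only [dist_eq_norm]
  exact lt_of_pow_lt_pow_left₀ 2 (norm_nonneg _) (hm hx hy hxy)

theorem strictMonoOn_dist_sub (φ : ℝ) :
    StrictMonoOn (fun x => dist (γ (φ - x)) (γ φ)) (Icc 0 x₁) := by
  have hd : ∀ x, HasDerivAt (fun x => ‖γ (φ - x) - γ φ‖ ^ 2)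
      (-(2 * ⟪deriv γ (φ - x), γ (φ - x) - γ φ⟫)) x := fun x => by
    simpa using (h.hasDerivAt_dist_sq φ (φ - x)).comp_const_sub φ x
  have hm : StrictMonoOn (fun x => ‖γ (φ - x) - γ φ‖ ^ 2) (Icc 0 x₁) := by
    refine strictMonoOn_of_deriv_pos (convex_Icc _ _)
      (fun x _ => (hd x).continuousAt.continuousWithinAt) fun x hx => ?_
    rw [interior_Icc] at hx
    rw [(hd x).deriv]
    have := h.inner_neg φ (-x) (by linarith [hx.2]) (by linarith [hx.1])
    rw [← sub_eq_add_neg] at this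
    linarith
  intro x hx y hy hxy
  simp only [dist_eq_norm]
  exact lt_of_pow_lt_pow_left₀ 2 (norm_nonneg _) (hm hx hy hxy)

theorem nextParam_spec (φ : ℝ) :
    nextParam r γ φ ∈ Ioo φ (φ + x₁) ∧ dist (γ (nextParam r γ φ)) (γ φ) = r ∧
      (∀ ψ ∈ Ico φ (nextParam r γ φ), dist (γ ψ) (γ φ) < r) ∧
      ∀ ψ ∈ Ioc (nextParam r γ φ) (φ + x₁), r < dist (γ ψ) (γ φ) := by
  obtain ⟨x, hx, hxr, hlt, hgt⟩ := exists_crossing (g := fun x => dist (γ (φ + x)) (γ φ)) h.pos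
    (by have := h.continuous; fun_prop)
    (h.strictMonoOn_dist_add φ) (by simpa using h.r_pos)
    (h.lt_dist φ x₁ le_rfl (by linarith [h.lt_pi]))
  have hlt' : ∀ ψ ∈ Ico φ (φ + x), dist (γ ψ) (γ φ) < r := fun ψ hψ => by
    simpa using hlt (ψ - φ) ⟨by linarith [hψ.1], by linarith [hψ.2]⟩
  have hp : nextParam r γ φ = φ + x := by
    refine IsLeast.csInf_eq ⟨⟨by linarith [hx.1], hxr⟩, fun ψ hψ => ?_⟩
    by_contra! hc
    exact (hlt' ψ ⟨hψ.1.le, hc⟩).ne hψ.2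
  rw [hp]
  refine ⟨⟨by linarith [hx.1], by linarith [hx.2]⟩, hxr, hlt', fun ψ hψ => ?_⟩
  simpa using hgt (ψ - φ) ⟨by linarith [hψ.1], by linarith [hψ.2]⟩

theorem prevParam_spec (φ : ℝ) :
    prevParam r γ φ ∈ Ioo (φ - x₁) φ ∧ dist (γ (prevParam r γ φ)) (γ φ) = r ∧
      (∀ ψ ∈ Ioc (prevParam r γ φ) φ, dist (γ ψ) (γ φ) < r) ∧
      ∀ ψ ∈ Ico (φ - x₁) (prevParam r γ φ), r < dist (γ ψ) (γ φ) := by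
  obtain ⟨x, hx, hxr, hlt, hgt⟩ := exists_crossing (g := fun x => dist (γ (φ - x)) (γ φ)) h.pos
    (by have := h.continuous; fun_prop)
    (h.strictMonoOn_dist_sub φ) (by simpa using h.r_pos) (by
      have := h.lt_dist φ (2 * π - x₁) (by linarith [h.lt_pi]) le_rfl
      rwa [show φ + (2 * π - x₁) = φ - x₁ + 2 * π by ring, h.periodic] at this)
  have hlt' : ∀ ψ ∈ Ioc (φ - x) φ, dist (γ ψ) (γ φ) < r := fun ψ hψ => by
    simpa using hlt (φ - ψ) ⟨by linarith [hψ.2], by linarith [hψ.1]⟩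
  have hp : prevParam r γ φ = φ - x := by
    refine IsGreatest.csSup_eq ⟨⟨by linarith [hx.1], hxr⟩, fun ψ hψ => ?_⟩
    by_contra! hc
    exact (hlt' ψ ⟨hc, hψ.1.le⟩).ne hψ.2
  rw [hp]
  refine ⟨⟨by linarith [hx.2], by linarith [hx.1]⟩, hxr, hlt', fun ψ hψ => ?_⟩
  simpa using hgt (φ - ψ) ⟨by linarith [hψ.2], by linarith [hψ.1]⟩

theorem nextParam_lt (φ : ℝ) : nextParam r γ φ < prevParam r γ φ + 2 * π := by
  linarith [(h.nextParam_spec φ).1.2, (h.prevParam_spec φ).1.1, h.lt_pi]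

/-- Monotonicity covers the two ends of the arc, the second after a shift by `2 * π`, and `lt_dist`
covers the middle. -/
theorem dist_gt_of_mem_Ioo (φ : ℝ) {ψ : ℝ}
    (hψ : ψ ∈ Ioo (nextParam r γ φ) (prevParam r γ φ + 2 * π)) : r < dist (γ ψ) (γ φ) := by
  rcases le_or_gt ψ (φ + x₁) with h1 | h1
  · exact (h.nextParam_spec φ).2.2.2 ψ ⟨hψ.1, h1⟩
  rcases le_or_gt (φ + 2 * π - x₁) ψ with h2 | h2
  · rw [← h.periodic.sub_eq ψ]
    exact (h.prevParam_spec φ).2.2.2 _ ⟨by linarith, by linarith [hψ.2]⟩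
  · simpa using h.lt_dist φ (ψ - φ) (by linarith) (by linarith)

theorem dist_lt_of_mem_Ioc (φ : ℝ) {ψ : ℝ}
    (hψ : ψ ∈ Ioc (prevParam r γ φ + 2 * π) (φ + 2 * π)) : dist (γ ψ) (γ φ) < r := by
  rw [← h.periodic.sub_eq ψ]
  exact (h.prevParam_spec φ).2.2.1 _ ⟨by linarith [hψ.1], by linarith [hψ.2]⟩

theorem meetsTwice (φ : ℝ) : MeetsTwice r γ φ := by
  refine ⟨?_, h.nextParam_lt φ⟩
  obtain ⟨hp, hpr, hplt, -⟩ := h.nextParam_spec φ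
  obtain ⟨hm, hmr, -, -⟩ := h.prevParam_spec φ
  have hlt := h.nextParam_lt φ
  have hπ := h.lt_pi
  have hpos := h.pos
  ext ψ
  simp only [mem_ofPred_eq, mem_insert_iff, mem_singleton_iff]
  constructor
  · rintro ⟨hψ, hr⟩
    by_contra! hne
    rcases lt_or_gt_of_ne hne.1 with h1 | h1
    · exact (hplt ψ ⟨hψ.1.le, h1⟩).ne hr
    rcases lt_or_gt_of_ne hne.2 with h2 | h2
    · exact (h.dist_gt_of_mem_Ioo φ ⟨h1, h2⟩).ne' hr
    · exact (h.dist_lt_of_mem_Ioc φ ⟨h2, hψ.2.le⟩).ne hr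
  · rintro (rfl | rfl)
    · exact ⟨⟨hp.1, by linarith [hp.2]⟩, hpr⟩
    · refine ⟨⟨by linarith [hm.1], by linarith [hm.2]⟩, ?_⟩
      rwa [h.periodic]

/-- The angle between the two chords thus lies strictly between `0` and `π`, which keeps the
arccosine differentiable and the square root in the derivative formula positive. -/
theorem cross_next_prev_pos (φ : ℝ) :
    0 < cross (γ (nextParam r γ φ) - γ φ) (γ (prevParam r γ φ) - γ φ) := by
  have := h.cross_chords_pos (h.nextParam_spec φ).1.1 (h.nextParam_lt φ)
    (by linarith [(h.prevParam_spec φ).1.2])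
  rwa [h.periodic] at this

theorem inner_nextParam_pos (φ : ℝ) :
    0 < ⟪deriv γ (nextParam r γ φ), γ (nextParam r γ φ) - γ φ⟫ := by
  obtain ⟨hp, -⟩ := h.nextParam_spec φ
  simpa using h.inner_pos φ (nextParam r γ φ - φ) (by linarith [hp.1]) (by linarith [hp.2])

theorem inner_prevParam_neg (φ : ℝ) :
    ⟪deriv γ (prevParam r γ φ), γ (prevParam r γ φ) - γ φ⟫ < 0 := by
  obtain ⟨hm, -⟩ := h.prevParam_spec φ
  simpa using h.inner_neg φ (prevParam r γ φ - φ) (by linarith [hm.1]) (by linarith [hm.2])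

theorem cross_sq_next_prev (φ : ℝ) :
    cross (γ (nextParam r γ φ) - γ φ) (γ (prevParam r γ φ) - γ φ) ^ 2 =
      r ^ 4 - ⟪γ (nextParam r γ φ) - γ φ, γ (prevParam r γ φ) - γ φ⟫ ^ 2 := by
  have := cross_sq_add_inner_sq (γ (nextParam r γ φ) - γ φ) (γ (prevParam r γ φ) - γ φ)
  rw [← dist_eq_norm, ← dist_eq_norm, (h.nextParam_spec φ).2.1, (h.prevParam_spec φ).2.1] at this
  linarith

theorem nonDegenerate (φ : ℝ) : NonDegenerate r γ φ := by
  refine ⟨(h.inner_nextParam_pos φ).ne', (h.inner_prevParam_neg φ).ne, ?_⟩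
  rw [← h.cross_sq_next_prev]
  exact pow_pos (h.cross_next_prev_pos φ) 2

end NearCircle

/-! ### Area of a region swept by segments from a point. -/

section Sweep

/-- The identification of the plane with `ℝ × ℝ`. -/
def coords : Plane ≃ᵐ ℝ × ℝ :=
  (MeasurableEquiv.toLp 2 (Fin 2 → ℝ)).symm.trans MeasurableEquiv.finTwoArrow

theorem measurePreserving_coords : MeasurePreserving coords volume volume :=
  (volume_preserving_finTwoArrow ℝ).comp (PiLp.volume_preserving_ofLp (Fin 2))

theorem continuous_coords : Continuous coords := by
  have : (coords : Plane → ℝ × ℝ) = fun v => (v 0, v 1) := rfl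
  rw [this]
  fun_prop

theorem volume_image_coords (A : Set Plane) : volume (coords '' A) = volume A := by
  rw [← measurePreserving_coords.measure_preimage_equiv, coords.injective.preimage_image]

/-- Polar-type coordinates around `q`: the point at fraction `s` on the segment from `q` to
`q + w ψ`. -/
def sweep (q : Plane) (w : ℝ → Plane) (z : ℝ × ℝ) : Plane := q + z.2 • w z.1

variable {q : Plane} {w w' : ℝ → Plane}

/-- The differential of `sweep` in coordinates. -/
def sweepFDeriv (w w' : ℝ → Plane) (z : ℝ × ℝ) : ℝ × ℝ →L[ℝ] ℝ × ℝ :=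
  (Matrix.toLin (.finTwoProd ℝ) (.finTwoProd ℝ)
    !![z.2 * w' z.1 0, w z.1 0; z.2 * w' z.1 1, w z.1 1]).toContinuousLinearMap

theorem det_sweepFDeriv (z : ℝ × ℝ) :
    (sweepFDeriv w w' z).det = -(z.2 * cross (w z.1) (w' z.1)) := by
  simp only [sweepFDeriv, LinearMap.det_toContinuousLinearMap, LinearMap.det_toLin,
    Matrix.det_fin_two_of, cross]
  ring

theorem hasDerivAt_apply {f : ℝ → Plane} {f' : Plane} {x : ℝ} (h : HasDerivAt f f' x) (i : Fin 2) :
    HasDerivAt (fun x => f x i) (f' i) x :=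
  hasDerivAt_pi.1 (((EuclideanSpace.equiv (Fin 2) ℝ).hasFDerivAt).comp_hasDerivAt x h) i

theorem hasFDerivAt_sweep (hw : ∀ ψ, HasDerivAt w (w' ψ) ψ) (z : ℝ × ℝ) :
    HasFDerivAt (fun z => coords (sweep q w z)) (sweepFDeriv w w' z) z := by
  have key : ∀ i, HasFDerivAt (fun z : ℝ × ℝ => q i + z.2 * w z.1 i)
      ((z.2 * w' z.1 i) • ContinuousLinearMap.fst ℝ ℝ ℝ +
        w z.1 i • ContinuousLinearMap.snd ℝ ℝ ℝ) z := by
    intro i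
    have h1 := (hasFDerivAt_snd (𝕜 := ℝ) (p := z)).mul
      ((hasDerivAt_apply (hw z.1) i).comp_hasFDerivAt z hasFDerivAt_fst)
    have h2 := h1.const_add (q i)
    convert! h2 using 1
    simp [smul_smul]
  rw [sweepFDeriv, Matrix.toLin_finTwoProd_toContinuousLinearMap]
  exact (key 0).prodMk (key 1)

theorem contDiff_sweep (hw : ContDiff ℝ 1 w) :
    ContDiff ℝ 1 (fun z => coords (sweep q w z)) := by
  have h : ∀ i, ContDiff ℝ 1 fun z : ℝ × ℝ => q i + z.2 * w z.1 i := fun i =>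
    contDiff_const.add (contDiff_snd.mul ((contDiff_euclidean.1 hw i).comp contDiff_fst))
  exact (h 0).prodMk (h 1)

/-- The Jacobian does not vanish on `D`, so the inverse function theorem makes the map open there.
-/
theorem isOpen_sweep_image (hw : ContDiff ℝ 1 w) {D : Set (ℝ × ℝ)} (hD : IsOpen D)
    (hne : ∀ z ∈ D, z.2 * cross (w z.1) (deriv w z.1) ≠ 0) : IsOpen (sweep q w '' D) := by
  have hd : ∀ ψ, HasDerivAt w (deriv w ψ) ψ := fun ψ =>
    (hw.differentiable one_ne_zero ψ).hasDerivAt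
  have himg : IsOpen ((fun z => coords (sweep q w z)) '' D) := by
    rw [isOpen_iff_mem_nhds]
    rintro _ ⟨z, hz, rfl⟩
    have hs := (contDiff_sweep (q := q) hw).contDiffAt.hasStrictFDerivAt'
      (hasFDerivAt_sweep hd z) one_ne_zero
    have hdet : (sweepFDeriv w (deriv w) z).det ≠ 0 := by
      rw [det_sweepFDeriv]
      exact neg_ne_zero.2 (hne z hz)
    have hmap := HasStrictFDerivAt.map_nhds_eq_of_equiv
      (f' := (sweepFDeriv w (deriv w) z).toContinuousLinearEquivOfDetNeZero hdet) hs
    rw [← hmap]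
    exact Filter.image_mem_map (hD.mem_nhds hz)
  have : sweep q w '' D = coords ⁻¹' ((fun z => coords (sweep q w z)) '' D) := by
    rw [← image_image coords (sweep q w), coords.injective.preimage_image]
  rw [this]
  exact himg.preimage continuous_coords

/-- Change of variables with Jacobian `s * cross (w ψ) (deriv w ψ)`, then Fubini; integrating `s`
from `0` to `τ ψ` yields the factor `τ ψ ^ 2 / 2`. -/
theorem volume_sweep_image (hw : ContDiff ℝ 1 w) {a b : ℝ} {τ : ℝ → ℝ} (hτ : Measurable τ)
    (hτ0 : ∀ ψ, 0 ≤ τ ψ) (hpos : ∀ ψ ∈ Ioo a b, 0 < cross (w ψ) (deriv w ψ))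
    (hinj : InjOn (sweep q w) (Ioo a b ×ˢ Ioi 0)) :
    volume (sweep q w '' regionBetween 0 τ (Ioo a b)) =
      ∫⁻ ψ in Ioo a b, ENNReal.ofReal (τ ψ ^ 2 * cross (w ψ) (deriv w ψ) / 2) := by
  have hd : ∀ ψ, HasDerivAt w (deriv w ψ) ψ := fun ψ =>
    (hw.differentiable one_ne_zero ψ).hasDerivAt
  have hsub : regionBetween 0 τ (Ioo a b) ⊆ Ioo a b ×ˢ Ioi 0 := fun z hz => ⟨hz.1, hz.2.1⟩
  have hmeas : MeasurableSet (regionBetween 0 τ (Ioo a b)) :=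
    measurableSet_regionBetween measurable_const hτ measurableSet_Ioo
  have hcc : Continuous fun ψ => cross (w ψ) (deriv w ψ) := by
    have h1 := hw.continuous
    have h2 := hw.continuous_deriv le_rfl
    simp only [cross]
    fun_prop
  have h1 := lintegral_abs_det_fderiv_eq_addHaar_image volume hmeas
    (fun z _ => (hasFDerivAt_sweep (q := q) hd z).hasFDerivWithinAt)
    ((coords.injective.comp_injOn (hinj.mono hsub)))
  have h2 : (fun z => coords (sweep q w z)) '' regionBetween 0 τ (Ioo a b) =
      coords '' (sweep q w '' regionBetween 0 τ (Ioo a b)) := (image_image _ _ _).symm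
  rw [h2, volume_image_coords] at h1
  rw [← h1, ← lintegral_indicator hmeas]
  have hG : Measurable fun z : ℝ × ℝ => ENNReal.ofReal |(sweepFDeriv w (deriv w) z).det| := by
    simp only [det_sweepFDeriv]
    refine (Continuous.measurable ?_).ennreal_ofReal
    exact (continuous_snd.mul (hcc.comp continuous_fst)).neg.abs
  rw [Measure.volume_eq_prod, lintegral_prod _ (hG.indicator hmeas).aemeasurable,
    ← lintegral_indicator measurableSet_Ioo]
  refine lintegral_congr fun ψ => ?_
  by_cases hψ : ψ ∈ Ioo a b
  · rw [indicator_of_mem hψ]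
    have h3 : ∀ s, (regionBetween 0 τ (Ioo a b)).indicator
        (fun z : ℝ × ℝ => ENNReal.ofReal |(sweepFDeriv w (deriv w) z).det|) (ψ, s) =
        (Ioo 0 (τ ψ)).indicator
          (fun s => ENNReal.ofReal (s * cross (w ψ) (deriv w ψ))) s := by
      intro s
      by_cases hs : s ∈ Ioo 0 (τ ψ)
      · rw [indicator_of_mem hs, indicator_of_mem (show (ψ, s) ∈ regionBetween 0 τ (Ioo a b) from
          ⟨hψ, hs⟩), det_sweepFDeriv, abs_neg, abs_of_pos (mul_pos hs.1 (hpos ψ hψ))]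
      · rw [indicator_of_notMem hs, indicator_of_notMem (fun h => hs h.2)]
    simp only [h3]
    rw [lintegral_indicator measurableSet_Ioo, ← ofReal_integral_eq_lintegral_ofReal,
      ← integral_Ioc_eq_integral_Ioo, ← intervalIntegral.integral_of_le (hτ0 ψ),
      intervalIntegral.integral_mul_const, integral_id]
    · congr 1
      ring
    · refine IntegrableOn.mono_set (t := Icc 0 (τ ψ)) ?_ Ioo_subset_Icc_self
      exact (continuous_id.mul continuous_const).continuousOn.integrableOn_compact isCompact_Icc
    · filter_upwards [ae_restrict_mem measurableSet_Ioo] with s hs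
      exact (mul_pos hs.1 (hpos ψ hψ)).le
  · rw [indicator_of_notMem hψ, lintegral_eq_zero_iff' (by
      exact ((hG.indicator hmeas).comp measurable_prodMk_left).aemeasurable)]
    exact .of_forall fun s => indicator_of_notMem (fun h => hψ h.1) _

end Sweep

/-! ### The interior of the curve and the area formula. -/

/-- If the trace of a closed curve together with an open set `U` disjoint from it forms a compact
set that is star-shaped, then `U` is the interior of the curve. -/
theorem inn_eq_of_starConvex {γ : ℝ → Plane} {U : Set Plane} {q : Plane} (hU : IsOpen U)
    (hd : Disjoint U (range γ)) (hK : IsCompact (U ∪ range γ))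
    (hs : StarConvex ℝ q (U ∪ range γ)) : inn γ = U := by
  have hq : q ∈ U ∪ range γ := by
    simpa using hs (Or.inr (mem_range_self 0)) zero_le_one le_rfl (add_zero 1)
  ext x
  constructor
  · rintro ⟨hxr, hb⟩
    by_contra hxU
    have hxK : x ∉ U ∪ range γ := fun h => h.elim hxU hxr
    have hne : x - q ≠ 0 := fun h0 => hxK (by rwa [sub_eq_zero.1 h0])
    -- A point outside the star-shaped set sees infinity along the ray away from `q`: if the ray met
    -- the set again, `x` would belong to it. So the component of `x` is unbounded.
    have hray : (fun t : ℝ => q + t • (x - q)) '' Ici 1 ⊆ (range γ)ᶜ := by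
      rintro _ ⟨t, ht, rfl⟩ hmem
      have ht : (1 : ℝ) ≤ t := ht
      have ht0 : 0 < t := by linarith
      refine hxK ?_
      have hti : t⁻¹ ≤ 1 := inv_le_one_of_one_le₀ ht
      have := hs (Or.inr hmem) (sub_nonneg.2 hti) (inv_nonneg.2 ht0.le) (by ring)
      convert! this using 1
      rw [smul_add, smul_smul, inv_mul_cancel₀ ht0.ne', one_smul, ← add_assoc, ← add_smul]
      simp
    have hcon : IsPreconnected ((fun t : ℝ => q + t • (x - q)) '' Ici 1) :=
      isPreconnected_Ici.image _ (by fun_prop)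
    have hsub := hb.subset (hcon.subset_connectedComponentIn
      ⟨1, self_mem_Ici, by simp⟩ hray)
    obtain ⟨C, hC⟩ := hsub.exists_norm_le
    set t := max 1 ((C + ‖q‖ + 1) / ‖x - q‖) with ht
    have h1 := hC _ ⟨t, mem_Ici.2 (le_max_left _ _), rfl⟩
    have h2 : C + ‖q‖ + 1 ≤ t * ‖x - q‖ :=
      (div_le_iff₀ (norm_pos_iff.2 hne)).1 (le_max_right _ _)
    have h3 : ‖t • (x - q)‖ = t * ‖x - q‖ := by
      rw [norm_smul, Real.norm_of_nonneg (zero_le_one.trans (le_max_left _ _))]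
    have h4 := norm_sub_le (q + t • (x - q)) q
    rw [add_sub_cancel_left, h3] at h4
    linarith
  · intro hx
    have hxr : x ∉ range γ := fun h => disjoint_left.1 hd hx h
    refine ⟨hxr, hK.isBounded.subset (Subset.trans ?_ subset_union_left)⟩
    -- Off the trace, the plane is the union of the disjoint open sets `U` and the complement of the
    -- compact set, so a component meeting `U` stays in it.
    refine isPreconnected_connectedComponentIn.subset_left_of_subset_union hU
      hK.isClosed.isOpen_compl (disjoint_left.2 fun y hy hy' => hy' (Or.inl hy)) (fun y hy => ?_)
      ⟨x, mem_connectedComponentIn hxr, hx⟩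
    by_cases hyU : y ∈ U
    · exact Or.inl hyU
    · exact Or.inr fun h => h.elim hyU (connectedComponentIn_subset _ _ hy)

theorem cross_zero_left (v : Plane) : cross 0 v = 0 := by simp [cross]

theorem cross_mul_cross_eq (u v v' : Plane) :
    ⟪u, v'⟫ * ‖v‖ ^ 2 - ⟪u, v⟫ * ⟪v, v'⟫ = -(cross u v * cross v v') := by
  rw [norm_sq_eq, inner_eq, inner_eq, inner_eq, cross, cross]
  ring

/-- The angle between a fixed vector `u` and a moving vector `v` changes at the rate
`cross v v' / ‖v‖ ^ 2` as long as `v` is to the left of `u`. -/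
theorem hasDerivAt_arccos_inner {u : Plane} {v : ℝ → Plane} {v' : Plane} {t : ℝ}
    (hv : HasDerivAt v v' t) (hc : 0 < cross u (v t)) :
    HasDerivAt (fun t => Real.arccos (⟪u, v t⟫ / (‖u‖ * ‖v t‖)))
      (cross (v t) v' / ‖v t‖ ^ 2) t := by
  have hu0 : 0 < ‖u‖ := norm_pos_iff.2 fun h => by simp [h, cross] at hc
  have hv0 : 0 < ‖v t‖ := norm_pos_iff.2 fun h => by simp [h, cross] at hc
  set x := ⟪u, v t⟫ / (‖u‖ * ‖v t‖)
  have hx : 1 - x ^ 2 = (cross u (v t) / (‖u‖ * ‖v t‖)) ^ 2 := by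
    have := cross_sq_add_inner_sq u (v t)
    simp only [x, div_pow]
    rw [eq_div_iff (by positivity), sub_mul, div_mul_cancel₀ _ (by positivity)]
    linarith [mul_pow ‖u‖ ‖v t‖ 2]
  have hpos : 0 < cross u (v t) / (‖u‖ * ‖v t‖) := by positivity
  have hsq : √(1 - x ^ 2) = cross u (v t) / (‖u‖ * ‖v t‖) := by
    rw [hx, Real.sqrt_sq hpos.le]
  have hx2 : 0 < 1 - x ^ 2 := by rw [hx]; positivity
  have h1 : x ≠ -1 := fun h => by rw [h] at hx2; norm_num at hx2
  have h2 : x ≠ 1 := fun h => by rw [h] at hx2; norm_num at hx2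
  have hN : HasDerivAt (fun t => ‖v t‖) (⟪v t, v'⟫ / ‖v t‖) t := by
    have := (hv.norm_sq).sqrt (by positivity)
    simp only [Real.sqrt_sq (norm_nonneg _)] at this
    convert! this using 1
    field_simp
  have hi : HasDerivAt (fun t => ⟪u, v t⟫) ⟪u, v'⟫ t := by
    simpa using (hasDerivAt_const t u).inner ℝ hv
  have hq := hi.div (hN.const_mul ‖u‖) (by positivity)
  have := (Real.hasDerivAt_arccos h1 h2).comp t hq
  refine this.congr_deriv ?_
  have hid := cross_mul_cross_eq u (v t) v'
  rw [hsq]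
  have e : ⟪u, v'⟫ * (‖u‖ * ‖v t‖) - ⟪u, v t⟫ * (‖u‖ * (⟪v t, v'⟫ / ‖v t‖)) =
      ‖u‖ / ‖v t‖ * -(cross u (v t) * cross (v t) v') := by
    rw [← hid]
    field_simp
  rw [e]
  field_simp

namespace NearCircle

variable {r x₁ : ℝ} {γ : ℝ → Plane} (h : NearCircle r x₁ γ)

include h

theorem contDiff_chord (φ : ℝ) : ContDiff ℝ 1 fun ψ => γ ψ - γ φ :=
  h.contDiff.sub contDiff_const

omit h in
theorem deriv_chord (φ ψ : ℝ) : deriv (fun ψ => γ ψ - γ φ) ψ = deriv γ ψ := by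
  simp

theorem cross_chord_deriv_pos {φ ψ : ℝ} (hψ : ψ ∈ Ioo φ (φ + 2 * π)) :
    0 < cross (γ ψ - γ φ) (deriv γ ψ) := by
  have := h.cross_right_pos hψ.1 hψ.2
  rwa [cross_swap, ← neg_sub, show -(γ ψ - γ φ) = (-1 : ℝ) • (γ ψ - γ φ) by simp,
    cross_smul_left, neg_one_mul, neg_neg] at this

theorem chord_ne_zero {φ ψ : ℝ} (hψ : ψ ∈ Ioo φ (φ + 2 * π)) : γ ψ - γ φ ≠ 0 := fun h0 => by
  have := h.cross_chord_deriv_pos hψ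
  simp [h0, cross] at this

theorem continuous_cross_chord (φ : ℝ) : Continuous fun ψ => cross (γ ψ - γ φ) (deriv γ ψ) := by
  have h1 := h.continuous
  have h2 := h.continuous_deriv
  simp only [cross, PiLp.sub_apply]
  fun_prop

/-- Two rays from `γ φ` with a common point would carry parallel chords, against the strict
positivity of their determinant. -/
theorem injOn_sweep (φ : ℝ) :
    InjOn (sweep (γ φ) fun ψ => γ ψ - γ φ) (Ioo φ (φ + 2 * π) ×ˢ Ioi 0) := by
  rintro ⟨a, s⟩ ⟨ha, hs⟩ ⟨b, t⟩ ⟨hb, ht⟩ hab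
  simp only [sweep, add_right_inj] at hab
  simp only [mem_Ioi] at hs ht ha hb
  have key : ∀ {a b s t : ℝ}, a ∈ Ioo φ (φ + 2 * π) → b ∈ Ioo φ (φ + 2 * π) → 0 < s → 0 < t →
      s • (γ a - γ φ) = t • (γ b - γ φ) → ¬ a < b := by
    intro a b s t ha hb hs ht hab hlt
    have h1 := h.cross_chords_pos ha.1 hlt hb.2
    have h2 := cross_self (s • (γ a - γ φ))
    nth_rw 2 [hab] at h2
    rw [cross_smul_left, cross_smul_right] at h2
    exact (mul_pos hs (mul_pos ht h1)).ne' h2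
  obtain rfl : a = b :=
    le_antisymm (not_lt.1 (key hb ha ht hs hab.symm)) (not_lt.1 (key ha hb hs ht hab))
  rw [smul_left_injective ℝ (h.chord_ne_zero ha) hab]

/-- The interior of the curve consists of the open segments from `γ φ` to the other points of the
curve. -/
theorem inn_eq (φ : ℝ) :
    inn γ = sweep (γ φ) (fun ψ => γ ψ - γ φ) '' (Ioo φ (φ + 2 * π) ×ˢ Ioo 0 1) := by
  set S := sweep (γ φ) fun ψ => γ ψ - γ φ with hS
  have hSc : Continuous S := by
    have := h.continuous
    exact continuous_const.add (continuous_snd.smul ((this.comp continuous_fst).sub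
      continuous_const))
  have hS1 : ∀ ψ, S (ψ, 1) = γ ψ := fun ψ => by simp [hS, sweep]
  have hrange : ∀ y ∈ range γ, ∃ ψ ∈ Ico φ (φ + 2 * π), γ ψ = y := by
    rintro _ ⟨t, rfl⟩
    obtain ⟨ψ, hψ, e⟩ := h.periodic.exists_mem_Ico Real.two_pi_pos t φ
    exact ⟨ψ, hψ, e.symm⟩
  have hK : S '' (Ioo φ (φ + 2 * π) ×ˢ Ioo 0 1) ∪ range γ =
      S '' (Icc φ (φ + 2 * π) ×ˢ Icc 0 1) := by
    apply Subset.antisymm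
    · rintro x (hx | hx)
      · exact image_mono (prod_mono Ioo_subset_Icc_self Ioo_subset_Icc_self) hx
      · obtain ⟨ψ, hψ, rfl⟩ := hrange x hx
        exact ⟨(ψ, 1), ⟨Ico_subset_Icc_self hψ, right_mem_Icc.2 zero_le_one⟩, hS1 ψ⟩
    · rintro _ ⟨⟨ψ, s⟩, ⟨hψ, hs⟩, rfl⟩
      rcases hs.1.eq_or_lt with h0 | h0
      · obtain rfl : 0 = s := h0
        exact Or.inr ⟨φ, by simp [hS, sweep]⟩
      rcases hs.2.eq_or_lt with h1 | h1
      · obtain rfl : s = 1 := h1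
        exact Or.inr ⟨ψ, (hS1 ψ).symm⟩
      rcases hψ.1.eq_or_lt with h2 | h2
      · obtain rfl : φ = ψ := h2
        exact Or.inr ⟨φ, by simp [hS, sweep]⟩
      rcases hψ.2.eq_or_lt with h3 | h3
      · obtain rfl : ψ = φ + 2 * π := h3
        exact Or.inr ⟨φ, by simp [hS, sweep, h.periodic φ]⟩
      · exact Or.inl ⟨(ψ, s), ⟨⟨h2, h3⟩, h0, h1⟩, rfl⟩
  refine inn_eq_of_starConvex (q := γ φ) ?_ ?_ ?_ ?_
  · refine isOpen_sweep_image (h.contDiff_chord φ) (isOpen_Ioo.prod isOpen_Ioo) ?_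
    rintro ⟨ψ, s⟩ ⟨hψ, hs⟩
    rw [deriv_chord]
    exact (mul_pos hs.1 (h.cross_chord_deriv_pos hψ)).ne'
  · rw [disjoint_left]
    rintro _ ⟨⟨ψ, s⟩, ⟨hψ, hs⟩, rfl⟩ hx
    obtain ⟨t, ht, e⟩ := hrange _ hx
    rcases ht.1.eq_or_lt with h2 | h2
    · obtain rfl : φ = t := h2
      simp only [hS, sweep] at e
      exact (smul_ne_zero hs.1.ne' (h.chord_ne_zero hψ)) (left_eq_add.1 e)
    · rw [← hS1 t] at e
      have := h.injOn_sweep φ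
        (mk_mem_prod ⟨h2, ht.2⟩ (mem_Ioi.2 one_pos)) (mk_mem_prod hψ (mem_Ioi.2 hs.1)) e
      exact hs.2.ne (congrArg Prod.snd this).symm
  · rw [hK]
    exact (isCompact_Icc.prod isCompact_Icc).image hSc
  · rw [hK]
    rintro _ ⟨⟨ψ, s⟩, ⟨hψ, hs⟩, rfl⟩ a b ha hb hab
    refine ⟨(ψ, b * s), ⟨hψ, mul_nonneg hb hs.1, mul_le_one₀ (by linarith) hs.1 hs.2⟩, ?_⟩
    simp only [hS, sweep, smul_add, smul_smul, ← add_assoc, ← add_smul, hab, one_smul]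

/-- Along the chord to `γ ψ` the curve is reached at fraction `1` and the disc is left at fraction
`r / ‖γ ψ - γ φ‖`; the smaller one bounds the swept region. -/
theorem invariant_eq_integral (φ : ℝ) :
    invariant r γ φ = ∫ ψ in φ..(φ + 2 * π),
      min 1 (r / ‖γ ψ - γ φ‖) ^ 2 * cross (γ ψ - γ φ) (deriv γ ψ) / 2 := by
  have hc := h.continuous
  have hτ : Measurable fun ψ => min 1 (r / ‖γ ψ - γ φ‖) :=
    measurable_const.min (measurable_const.div (by fun_prop : Continuous _).measurable)
  have hτ0 : ∀ ψ, 0 ≤ min 1 (r / ‖γ ψ - γ φ‖) := fun ψ =>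
    le_min zero_le_one (div_nonneg h.r_pos.le (norm_nonneg _))
  have hset : Metric.ball (γ φ) r ∩ inn γ = sweep (γ φ) (fun ψ => γ ψ - γ φ) ''
      regionBetween 0 (fun ψ => min 1 (r / ‖γ ψ - γ φ‖)) (Ioo φ (φ + 2 * π)) := by
    have hball : ∀ ψ ∈ Ioo φ (φ + 2 * π), ∀ s, 0 < s →
        (sweep (γ φ) (fun ψ => γ ψ - γ φ) (ψ, s) ∈ Metric.ball (γ φ) r ↔
          s < r / ‖γ ψ - γ φ‖) := by
      intro ψ hψ s hs
      rw [mem_ball_iff_norm, sweep, add_sub_cancel_left, norm_smul, Real.norm_of_nonneg hs.le,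
        lt_div_iff₀ (norm_pos_iff.2 (h.chord_ne_zero hψ))]
    rw [h.inn_eq φ]
    ext x
    constructor
    · rintro ⟨hx, ⟨ψ, s⟩, ⟨hψ, hs⟩, rfl⟩
      exact ⟨(ψ, s), ⟨hψ, hs.1, lt_min hs.2 ((hball ψ hψ s hs.1).1 hx)⟩, rfl⟩
    · rintro ⟨⟨ψ, s⟩, ⟨hψ, hs⟩, rfl⟩
      exact ⟨(hball ψ hψ s hs.1).2 (hs.2.trans_le (min_le_right _ _)), (ψ, s),
        ⟨hψ, hs.1, hs.2.trans_le (min_le_left _ _)⟩, rfl⟩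
  have hvol := volume_sweep_image (q := γ φ) (h.contDiff_chord φ) hτ hτ0
    (fun ψ hψ => by rw [deriv_chord]; exact h.cross_chord_deriv_pos hψ) (h.injOn_sweep φ)
  simp only [deriv_chord] at hvol
  rw [invariant, hset, hvol, intervalIntegral.integral_of_le (by linarith [Real.pi_pos]),
    integral_Ioc_eq_integral_Ioo, integral_eq_lintegral_of_nonneg_ae]
  · filter_upwards [ae_restrict_mem measurableSet_Ioo] with ψ hψ
    exact div_nonneg (mul_nonneg (sq_nonneg _) (h.cross_chord_deriv_pos hψ).le) two_pos.le
  · exact (((hτ.pow_const 2).mul (h.continuous_cross_chord φ).measurable).div_const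
      2).aestronglyMeasurable

/-- The integrand is the angular velocity of the chord. Its primitive is the angle measured from the
chord to `p`, which stays in `[0, π]`, so one branch of arccosine suffices. -/
theorem integral_angle (φ : ℝ) :
    ∫ ψ in (nextParam r γ φ)..(prevParam r γ φ + 2 * π),
        cross (γ ψ - γ φ) (deriv γ ψ) / ‖γ ψ - γ φ‖ ^ 2 =
      Real.arccos (⟪γ (nextParam r γ φ) - γ φ, γ (prevParam r γ φ) - γ φ⟫ / r ^ 2) := by
  obtain ⟨hp, hpr, -⟩ := h.nextParam_spec φ
  obtain ⟨hm, hmr, -⟩ := h.prevParam_spec φ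
  have hlt := h.nextParam_lt φ
  have hγ := h.continuous
  rw [dist_eq_norm] at hpr hmr
  set p := nextParam r γ φ
  set m := prevParam r γ φ
  have hsub : Icc p (m + 2 * π) ⊆ Ioo φ (φ + 2 * π) := fun ψ hψ =>
    ⟨by linarith [hψ.1, hp.1], by linarith [hψ.2, hm.2]⟩
  have hne : ∀ ψ ∈ Icc p (m + 2 * π), ‖γ ψ - γ φ‖ ≠ 0 := fun ψ hψ =>
    norm_ne_zero_iff.2 (h.chord_ne_zero (hsub hψ))
  have hr := h.r_pos
  rw [intervalIntegral.integral_eq_sub_of_hasDerivAt_of_le (f := fun ψ =>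
    Real.arccos (⟪γ p - γ φ, γ ψ - γ φ⟫ / (‖γ p - γ φ‖ * ‖γ ψ - γ φ‖))) hlt.le]
  · have hone : ⟪γ p - γ φ, γ p - γ φ⟫ / (‖γ p - γ φ‖ * ‖γ p - γ φ‖) = 1 := by
      rw [real_inner_self_eq_norm_sq, hpr]
      field_simp
    rw [hone, Real.arccos_one, sub_zero, h.periodic, hpr, hmr, ← sq]
  · refine Real.continuous_arccos.comp_continuousOn (ContinuousOn.div (by fun_prop) (by fun_prop) ?_)
    intro ψ hψ
    rw [hpr]
    exact mul_ne_zero hr.ne' (hne ψ hψ)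
  · intro ψ hψ
    exact hasDerivAt_arccos_inner ((h.hasDerivAt ψ).sub_const (γ φ))
      (h.cross_chords_pos hp.1 hψ.1 (hsub (Ioo_subset_Icc_self hψ)).2)
  · refine ContinuousOn.intervalIntegrable ?_
    rw [uIcc_of_le hlt.le]
    exact (h.continuous_cross_chord φ).continuousOn.div (by fun_prop) fun ψ hψ =>
      pow_ne_zero 2 (hne ψ hψ)

theorem invariant_eq_invariantFormula (φ : ℝ) : invariant r γ φ = invariantFormula r γ φ := by
  have hangle := h.integral_angle φ
  obtain ⟨hp, hpr, hplt, -⟩ := h.nextParam_spec φ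
  obtain ⟨hm, hmr, -⟩ := h.prevParam_spec φ
  have hlt := h.nextParam_lt φ
  have hgt := fun ψ => h.dist_gt_of_mem_Ioo φ (ψ := ψ)
  have hin := fun ψ => h.dist_lt_of_mem_Ioc φ (ψ := ψ)
  have hcross := h.continuous_cross_chord φ
  have hr := h.r_pos
  have hγ := h.continuous
  rw [h.invariant_eq_integral, invariantFormula]
  simp only [inner_perp]
  set p := nextParam r γ φ
  set m := prevParam r γ φ
  set D := fun ψ => cross (γ ψ - γ φ) (deriv γ ψ) with hD
  set f := fun ψ => min 1 (r / ‖γ ψ - γ φ‖) ^ 2 * D ψ / 2 with hf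
  have hnear : ∀ ψ, dist (γ ψ) (γ φ) ≤ r → f ψ = 1 / 2 * D ψ := by
    intro ψ hψ
    rw [dist_eq_norm] at hψ
    -- At a zero chord `r / 0 = 0` makes the minimum `0` instead of `1`, but `D ψ` vanishes there
    -- too.
    rcases eq_or_ne (γ ψ - γ φ) 0 with h0 | h0
    · simp only [hf, hD, h0, cross_zero_left, mul_zero, zero_div]
    · have : 1 ≤ r / ‖γ ψ - γ φ‖ := (one_le_div (norm_pos_iff.2 h0)).2 hψ
      simp only [hf, min_eq_left this]
      ring
  have h1 : ∀ ψ ∈ Icc φ p, f ψ = 1 / 2 * D ψ := fun ψ hψ => hnear ψ <| by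
    rcases hψ.2.eq_or_lt with e | e
    · rw [e, hpr]
    · exact (hplt ψ ⟨hψ.1, e⟩).le
  have h3 : ∀ ψ ∈ Icc (m + 2 * π) (φ + 2 * π), f ψ = 1 / 2 * D ψ := fun ψ hψ => hnear ψ <| by
    rcases hψ.1.eq_or_lt with e | e
    · rw [← e, h.periodic, hmr]
    · exact (hin ψ ⟨e, hψ.2⟩).le
  have hfar : ∀ ψ ∈ Icc p (m + 2 * π), r ≤ ‖γ ψ - γ φ‖ := by
    intro ψ hψ
    rw [← dist_eq_norm]
    rcases hψ.1.eq_or_lt with e | e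
    · rw [← e, hpr]
    rcases hψ.2.eq_or_lt with e' | e'
    · rw [e', h.periodic, hmr]
    · exact (hgt ψ ⟨e, e'⟩).le
  have h2 : ∀ ψ ∈ Icc p (m + 2 * π), f ψ = r ^ 2 / 2 * (D ψ / ‖γ ψ - γ φ‖ ^ 2) := by
    intro ψ hψ
    have hr' := hfar ψ hψ
    have : r / ‖γ ψ - γ φ‖ ≤ 1 := (div_le_one (hr.trans_le hr')).2 hr'
    simp only [hf, min_eq_right this, div_pow]
    ring
  have e1 : φ ≤ p := hp.1.le
  have e3 : m + 2 * π ≤ φ + 2 * π := by linarith [hm.2]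
  have i1 : IntervalIntegrable f volume φ p := by
    refine ContinuousOn.intervalIntegrable ?_
    rw [uIcc_of_le e1]
    exact (continuous_const.mul hcross).continuousOn.congr h1
  have i2 : IntervalIntegrable f volume p (m + 2 * π) := by
    refine ContinuousOn.intervalIntegrable ?_
    rw [uIcc_of_le hlt.le]
    refine ContinuousOn.congr (continuousOn_const.mul (hcross.continuousOn.div (by fun_prop) ?_)) h2
    exact fun ψ hψ => pow_ne_zero 2 (hr.trans_le (hfar ψ hψ)).ne'
  have i3 : IntervalIntegrable f volume (m + 2 * π) (φ + 2 * π) := by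
    refine ContinuousOn.intervalIntegrable ?_
    rw [uIcc_of_le e3]
    exact (continuous_const.mul hcross).continuousOn.congr h3
  have c1 : ∫ ψ in φ..p, f ψ = 1 / 2 * ∫ ψ in φ..p, D ψ := by
    rw [← intervalIntegral.integral_const_mul]
    exact intervalIntegral.integral_congr fun ψ hψ => h1 ψ (by rwa [uIcc_of_le e1] at hψ)
  have c2 : ∫ ψ in p..(m + 2 * π), f ψ =
      r ^ 2 / 2 * Real.arccos (⟪γ p - γ φ, γ m - γ φ⟫ / r ^ 2) := by
    rw [← hangle, ← intervalIntegral.integral_const_mul]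
    exact intervalIntegral.integral_congr fun ψ hψ => h2 ψ (by rwa [uIcc_of_le hlt.le] at hψ)
  -- Shifted back by one period, the last arc joins the first to form the interval from `m` to `p`.
  have c3 : ∫ ψ in (m + 2 * π)..(φ + 2 * π), f ψ = 1 / 2 * ∫ ψ in m..φ, D ψ := by
    rw [← intervalIntegral.integral_const_mul, ← intervalIntegral.integral_comp_add_right]
    refine intervalIntegral.integral_congr fun ψ hψ => ?_
    rw [uIcc_of_le hm.2.le] at hψ
    change f (ψ + 2 * π) = 1 / 2 * D ψ
    rw [h3 _ ⟨by linarith [hψ.1], by linarith [hψ.2]⟩]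
    simp only [hD, h.periodic ψ, h.deriv_add_two_pi]
  rw [← intervalIntegral.integral_add_adjacent_intervals (i1.trans i2) i3,
    ← intervalIntegral.integral_add_adjacent_intervals i1 i2, c1, c2, c3,
    ← intervalIntegral.integral_add_adjacent_intervals (hcross.intervalIntegrable m φ)
      (hcross.intervalIntegrable φ p)]
  ring

end NearCircle

/-! ### Joint smoothness of the formula in the curve and the parameter. -/

/-- A solution `p` of a scalar equation `G (y, p y) = const` that is locally unique near a point
where the equation is nondegenerate is as smooth as `G`. -/
theorem contDiffAt_of_unique_solution {Y : Type*} [NormedAddCommGroup Y] [NormedSpace ℝ Y]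
    [CompleteSpace Y] {n : WithTop ℕ∞} (hn : n ≠ 0) {G : Y × ℝ → ℝ} {y₀ : Y} {p : Y → ℝ}
    (hG : ContDiffAt ℝ n G (y₀, p y₀)) {d : ℝ} (hd : HasDerivAt (fun x => G (y₀, x)) d (p y₀))
    (hd0 : d ≠ 0)
    (huniq : ∀ᶠ z in 𝓝 (y₀, p y₀), G z = G (y₀, p y₀) → z.2 = p z.1) :
    ContDiffAt ℝ n p y₀ := by
  have hder : fderiv ℝ G (y₀, p y₀) (0, 1) = d :=
    ((hG.differentiableAt hn).hasFDerivAt.comp_hasDerivAt (p y₀)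
      ((hasDerivAt_const (p y₀) y₀).prodMk (hasDerivAt_id (p y₀)))).unique hd
  have hinv : (fderiv ℝ G (y₀, p y₀) ∘L .inr ℝ Y ℝ).IsInvertible := by
    refine ⟨ContinuousLinearEquiv.unitsEquivAut ℝ (Units.mk0 d hd0), ?_⟩
    ext
    simp [hder]
  have hc := hG.contDiffAt_implicitFunction hn hinv
  have hself := hG.implicitFunction_apply_self hn hinv
  have htend : Filter.Tendsto (fun y => (y, hG.implicitFunction hn hinv y)) (𝓝 y₀)
      (𝓝 (y₀, p y₀)) := by
    have h := hc.continuousAt.tendsto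
    rw [hself] at h
    exact Filter.tendsto_id.prodMk_nhds h
  refine hc.congr_of_eventuallyEq ?_
  filter_upwards [htend.eventually huniq, hG.eventually_apply_implicitFunction hn hinv]
    with y h1 h2
  exact (h1 h2).symm

theorem contDiff_integral {W : Type*} [NormedAddCommGroup W] [NormedSpace ℝ W] [CompleteSpace W]
    {b : ℝ → W} {m : ℕ} (hb : ContDiff ℝ m b) (a : ℝ) :
    ContDiff ℝ (m + 1 : ℕ) fun s => ∫ x in a..s, b x := by
  have hd := fun s => (hb.continuous.integral_hasStrictDerivAt a s).hasDerivAt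
  push_cast
  refine contDiff_succ_iff_deriv.2 ⟨fun s => (hd s).differentiableAt, by simp, ?_⟩
  rwa [show deriv (fun s => ∫ x in a..s, b x) = b from funext fun s => (hd s).deriv]

theorem CkCircle.contDiff_eval {n m : ℕ} {E : Type*} [NormedAddCommGroup E] [NormedSpace ℝ E]
    (hm : m + 1 ≤ n) : ContDiff ℝ m (fun z : CkCircle n E × ℝ => z.1 z.2) := by
  have h := ((contDiff_evJet (k := n) (E := E) (j := 0) (m := m) (by omega)).comp
    (contDiff_snd (E := CkCircle n E) (F := ℝ))).clm_apply (contDiff_fst (E := CkCircle n E))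
  simpa only [Function.comp_def, evJet_zero_apply] using h

theorem CkCircle.hasDerivAt {n : ℕ} {E : Type*} [NormedAddCommGroup E] [NormedSpace ℝ E]
    (hn : 1 ≤ n) (f : CkCircle n E) (x : ℝ) : HasDerivAt f (deriv f x) x := by
  simpa only [iteratedDeriv_zero, zero_add, iteratedDeriv_one] using
    f.hasDerivAt_iteratedDeriv (j := 0) hn x

namespace NearCircle

variable {r x₁ : ℝ} {γ : ℝ → Plane} (h : NearCircle r x₁ γ)

include h

theorem eq_nextParam {φ ψ : ℝ} (hψ : ψ ∈ Ioo φ (φ + x₁)) (hr : dist (γ ψ) (γ φ) = r) :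
    ψ = nextParam r γ φ := by
  obtain ⟨-, -, h1, h2⟩ := h.nextParam_spec φ
  by_contra hne
  rcases lt_or_gt_of_ne hne with hlt | hlt
  · exact (h1 ψ ⟨hψ.1.le, hlt⟩).ne hr
  · exact (h2 ψ ⟨hlt, hψ.2.le⟩).ne' hr

theorem eq_prevParam {φ ψ : ℝ} (hψ : ψ ∈ Ioo (φ - x₁) φ) (hr : dist (γ ψ) (γ φ) = r) :
    ψ = prevParam r γ φ := by
  obtain ⟨-, -, h1, h2⟩ := h.prevParam_spec φ
  by_contra hne
  rcases lt_or_gt_of_ne hne with hlt | hlt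
  · exact (h2 ψ ⟨hψ.1.le, hlt⟩).ne' hr
  · exact (h1 ψ ⟨hlt, hψ.2.le⟩).ne hr

end NearCircle

section Smoothness

variable {n m : ℕ} {r x₁ : ℝ} {V : Set (CkCircle n Plane)}

theorem contDiff_dist_sq (hm : m + 1 ≤ n) :
    ContDiff ℝ m (fun z : (CkCircle n Plane × ℝ) × ℝ => ‖z.1.1 z.2 - z.1.1 z.1.2‖ ^ 2) := by
  have h := CkCircle.contDiff_eval (E := Plane) hm
  exact ((h.comp (contDiff_fst.fst.prodMk contDiff_snd)).sub (h.comp contDiff_fst)).norm_sq ℝ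

/-- The derivative of the squared distance in `ψ` is positive at `p`. Uniqueness of the solution
persists near `(γ, φ)` because the window `(φ, φ + x₁)` is open and `x₁` is common to all curves in
`V`. -/
theorem contDiffAt_nextParam (hm : m + 1 ≤ n) (hm0 : m ≠ 0) (hV : IsOpen V)
    (hnear : ∀ γ ∈ V, NearCircle r x₁ γ) {γ : CkCircle n Plane} (hγ : γ ∈ V) (φ : ℝ) :
    ContDiffAt ℝ m (fun z : CkCircle n Plane × ℝ => nextParam r z.1 z.2) (γ, φ) := by
  have h := hnear γ hγ
  obtain ⟨hp, hpr, -⟩ := h.nextParam_spec φ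
  refine contDiffAt_of_unique_solution (by exact_mod_cast hm0)
    (contDiff_dist_sq hm).contDiffAt (h.hasDerivAt_dist_sq φ _)
    (mul_ne_zero two_ne_zero (h.inner_nextParam_pos φ).ne') ?_
  have h1 : ∀ᶠ z : (CkCircle n Plane × ℝ) × ℝ in 𝓝 ((γ, φ), nextParam r γ φ), z.1.1 ∈ V :=
    (continuous_fst.fst.tendsto _).eventually (hV.mem_nhds hγ)
  have h2 : ∀ᶠ z : (CkCircle n Plane × ℝ) × ℝ in 𝓝 ((γ, φ), nextParam r γ φ), z.1.2 < z.2 :=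
    (isOpen_lt continuous_fst.snd continuous_snd).mem_nhds hp.1
  have h3 : ∀ᶠ z : (CkCircle n Plane × ℝ) × ℝ in 𝓝 ((γ, φ), nextParam r γ φ),
      z.2 < z.1.2 + x₁ :=
    (isOpen_lt continuous_snd (continuous_fst.snd.add continuous_const)).mem_nhds hp.2
  filter_upwards [h1, h2, h3] with z hz1 hz2 hz3 hz
  refine (hnear _ hz1).eq_nextParam ⟨hz2, hz3⟩ ?_
  rw [dist_eq_norm] at hpr ⊢
  simp only [hpr] at hz
  exact (pow_left_inj₀ (norm_nonneg _) h.r_pos.le two_ne_zero).1 hz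

theorem contDiffAt_prevParam (hm : m + 1 ≤ n) (hm0 : m ≠ 0) (hV : IsOpen V)
    (hnear : ∀ γ ∈ V, NearCircle r x₁ γ) {γ : CkCircle n Plane} (hγ : γ ∈ V) (φ : ℝ) :
    ContDiffAt ℝ m (fun z : CkCircle n Plane × ℝ => prevParam r z.1 z.2) (γ, φ) := by
  have h := hnear γ hγ
  obtain ⟨hp, hpr, -⟩ := h.prevParam_spec φ
  refine contDiffAt_of_unique_solution (by exact_mod_cast hm0)
    (contDiff_dist_sq hm).contDiffAt (h.hasDerivAt_dist_sq φ _)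
    (mul_ne_zero two_ne_zero (h.inner_prevParam_neg φ).ne) ?_
  have h1 : ∀ᶠ z : (CkCircle n Plane × ℝ) × ℝ in 𝓝 ((γ, φ), prevParam r γ φ), z.1.1 ∈ V :=
    (continuous_fst.fst.tendsto _).eventually (hV.mem_nhds hγ)
  have h2 : ∀ᶠ z : (CkCircle n Plane × ℝ) × ℝ in 𝓝 ((γ, φ), prevParam r γ φ),
      z.1.2 - x₁ < z.2 :=
    (isOpen_lt (continuous_fst.snd.sub continuous_const) continuous_snd).mem_nhds hp.1
  have h3 : ∀ᶠ z : (CkCircle n Plane × ℝ) × ℝ in 𝓝 ((γ, φ), prevParam r γ φ), z.2 < z.1.2 :=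
    (isOpen_lt continuous_snd continuous_fst.snd).mem_nhds hp.2
  filter_upwards [h1, h2, h3] with z hz1 hz2 hz3 hz
  refine (hnear _ hz1).eq_prevParam ⟨hz2, hz3⟩ ?_
  rw [dist_eq_norm] at hpr ⊢
  simp only [hpr] at hz
  exact (pow_left_inj₀ (norm_nonneg _) h.r_pos.le two_ne_zero).1 hz

/-- The determinant as a continuous bilinear map. -/
def crossCLM : Plane →L[ℝ] Plane →L[ℝ] ℝ :=
  LinearMap.mkContinuous₂ (LinearMap.mk₂ ℝ cross cross_add_left cross_smul_left cross_add_right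
    cross_smul_right) 1 fun v w => by
      rw [one_mul]
      exact abs_cross_le v w

theorem crossCLM_apply (v w : Plane) : crossCLM v w = cross v w := rfl

/-- The bilinear form `(f, g) ↦ cross (f s) (g' s)`. -/
def areaDensity (hn : 1 ≤ n) (s : ℝ) : CkCircle n Plane →L[ℝ] CkCircle n Plane →L[ℝ] ℝ :=
  (ContinuousLinearMap.compL ℝ (CkCircle n Plane) Plane ℝ).flip (CkCircle.evJet hn s) ∘L
    (crossCLM ∘L CkCircle.evJet (Nat.zero_le n) s)

theorem areaDensity_apply (hn : 1 ≤ n) (s : ℝ) (f g : CkCircle n Plane) :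
    areaDensity hn s f g = cross (f s) (deriv g s) := by
  simp only [areaDensity, ContinuousLinearMap.flip_apply, ContinuousLinearMap.comp_apply,
    ContinuousLinearMap.compL_apply,
    CkCircle.evJet_zero_apply, CkCircle.evJet_one_apply, crossCLM_apply]

theorem contDiff_areaDensity (hm : m + 2 ≤ n) :
    ContDiff ℝ m (areaDensity (by omega : 1 ≤ n)) := by
  have h0 := CkCircle.contDiff_evJet (k := n) (E := Plane) (j := 0) (m := m) (by omega)
  have h1 := CkCircle.contDiff_evJet (k := n) (E := Plane) (j := 1) (m := m) (by omega)
  exact ((ContinuousLinearMap.compL ℝ (CkCircle n Plane) Plane ℝ).flip.contDiff.comp h1).clm_comp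
    ((contDiff_const (c := crossCLM)).clm_comp h0)

/-- The bilinear form `(f, g) ↦ ∫₀ˢ cross f g'`. -/
def areaForm (hn : 1 ≤ n) (s : ℝ) : CkCircle n Plane →L[ℝ] CkCircle n Plane →L[ℝ] ℝ :=
  ∫ ψ in (0 : ℝ)..s, areaDensity hn ψ

theorem continuous_areaDensity (hn : 2 ≤ n) :
    Continuous (areaDensity (by omega : 1 ≤ n)) :=
  (contDiff_areaDensity (m := 0) (by omega)).continuous

theorem areaForm_apply (hn : 2 ≤ n) (s : ℝ) (f g : CkCircle n Plane) :
    areaForm (by omega) s f g = ∫ ψ in (0 : ℝ)..s, cross (f ψ) (deriv g ψ) := by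
  have hc := continuous_areaDensity hn
  rw [areaForm, ContinuousLinearMap.intervalIntegral_apply (hc.intervalIntegrable _ _),
    ContinuousLinearMap.intervalIntegral_apply ((hc.clm_apply
      continuous_const).intervalIntegrable _ _)]
  simp only [areaDensity_apply]

/-- The density uses `deriv g` and is only `C^(n-2)` in operator norm; integration restores the lost
derivative, so the integral is as smooth as evaluation. -/
theorem contDiff_areaForm (hm : m + 1 ≤ n) (hm0 : m ≠ 0) (hn : 1 ≤ n) :
    ContDiff ℝ m (areaForm hn) := by
  obtain ⟨m, rfl⟩ := Nat.exists_eq_add_one_of_ne_zero hm0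
  exact contDiff_integral (contDiff_areaDensity (by omega)) 0

theorem CkCircle.continuous_deriv (hn : 1 ≤ n) (f : CkCircle n Plane) : Continuous (deriv f) :=
  f.contDiff.continuous_deriv (by exact_mod_cast hn)

theorem CkCircle.continuous (f : CkCircle n Plane) : Continuous f := f.contDiff.continuous

theorem _root_.HasDerivAt.cross {f g : ℝ → Plane} {f' g' : Plane} {x : ℝ} (hf : HasDerivAt f f' x)
    (hg : HasDerivAt g g' x) :
    HasDerivAt (fun t => cross (f t) (g t)) (cross f' (g x) + CircInv.cross (f x) g') x := by
  have h := ((crossCLM.hasFDerivAt.comp_hasDerivAt x hf).clm_apply hg)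
  exact h

theorem _root_.Continuous.cross {α : Type*} [TopologicalSpace α] {f g : α → Plane}
    (hf : Continuous f) (hg : Continuous g) : Continuous fun t => cross (f t) (g t) := by
  simp only [CircInv.cross]
  fun_prop

theorem hasDerivAt_areaForm_apply (hn : 2 ≤ n) (f g : CkCircle n Plane) (s : ℝ) :
    HasDerivAt (fun s => areaForm (by omega) s f g) (cross (f s) (deriv g s)) s := by
  simp only [areaForm_apply hn]
  exact ((f.continuous.cross (g.continuous_deriv (by omega))).integral_hasStrictDerivAt
    0 s).hasDerivAt

/-- Integration by parts for the area form. -/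
theorem areaForm_swap (hn : 2 ≤ n) (s : ℝ) (f g : CkCircle n Plane) :
    areaForm (by omega) s f g =
      areaForm (by omega) s g f + cross (f s) (g s) - cross (f 0) (g 0) := by
  have hd := fun x => (f.hasDerivAt (by omega) x).cross (g.hasDerivAt (by omega) x)
  have hf := f.continuous
  have hg := g.continuous
  have hf' := f.continuous_deriv (by omega)
  have hg' := g.continuous_deriv (by omega)
  have h1 := (hf'.cross hg).intervalIntegrable (μ := volume) 0 s
  have h2 := (hf.cross hg').intervalIntegrable (μ := volume) 0 s
  have hint := intervalIntegral.integral_eq_sub_of_hasDerivAt (fun x _ => hd x) (h1.add h2)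
  rw [intervalIntegral.integral_add h1 h2] at hint
  have h3 : ∫ ψ in (0 : ℝ)..s, cross (g ψ) (deriv f ψ) =
      -∫ ψ in (0 : ℝ)..s, cross (deriv f ψ) (g ψ) := by
    rw [← intervalIntegral.integral_neg]
    exact intervalIntegral.integral_congr fun ψ _ => cross_swap _ _
  rw [areaForm_apply hn, areaForm_apply hn, h3]
  linarith

theorem integral_cross_eq_areaForm (hn : 2 ≤ n) (a b : ℝ) (f g : CkCircle n Plane) :
    ∫ ψ in a..b, cross (f ψ) (deriv g ψ) =
      areaForm (by omega) b f g - areaForm (by omega) a f g := by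
  have hc := f.continuous.cross (g.continuous_deriv (by omega))
  rw [areaForm_apply hn, areaForm_apply hn, intervalIntegral.integral_interval_sub_left
    (hc.intervalIntegrable _ _) (hc.intervalIntegrable _ _)]

/-- The integral with moving endpoints becomes a difference of values of one smooth operator-valued
curve, applied to `γ` twice. This form serves both smoothness and differentiation. -/
theorem invariantFormula_eq (hn : 2 ≤ n) (r : ℝ) (γ : CkCircle n Plane) (φ : ℝ) :
    invariantFormula r γ φ =
      1 / 2 * (areaForm (by omega) (nextParam r γ φ) γ γ - areaForm (by omega) (prevParam r γ φ) γ γ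
        - cross (γ φ) (γ (nextParam r γ φ) - γ (prevParam r γ φ)))
      + r ^ 2 / 2 * Real.arccos
        (⟪γ (nextParam r γ φ) - γ φ, γ (prevParam r γ φ) - γ φ⟫ / r ^ 2) := by
  rw [invariantFormula]
  simp only [inner_perp, cross_sub_left]
  generalize nextParam r γ φ = p
  generalize prevParam r γ φ = m
  have hc := γ.continuous_deriv (by omega)
  have hd : ∀ x, HasDerivAt (fun x => cross (γ φ) (γ x)) (cross (γ φ) (deriv γ x)) x := fun x => by
    simpa [cross_zero_left] using (hasDerivAt_const x (γ φ)).cross (γ.hasDerivAt (by omega) x)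
  have h2 : Continuous fun x => cross (γ φ) (deriv γ x) := continuous_const.cross hc
  rw [intervalIntegral.integral_sub ((γ.continuous.cross hc).intervalIntegrable _ _)
    (h2.intervalIntegrable _ _), integral_cross_eq_areaForm hn,
    intervalIntegral.integral_eq_sub_of_hasDerivAt (fun x _ => hd x) (h2.intervalIntegrable _ _),
    cross_sub_right]

theorem NearCircle.cos_angle_sq_lt_one {γ : ℝ → Plane} (h : NearCircle r x₁ γ) (φ : ℝ) :
    (⟪γ (nextParam r γ φ) - γ φ, γ (prevParam r γ φ) - γ φ⟫ / r ^ 2) ^ 2 < 1 := by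
  have h1 := (h.nonDegenerate φ).2.2
  have hr := h.r_pos
  rw [div_pow, div_lt_one (by positivity), ← pow_mul]
  exact sub_pos.1 h1

theorem contDiffOn_invariantFormula (hm : m + 1 ≤ n) (hm0 : m ≠ 0) (hV : IsOpen V)
    (hnear : ∀ γ ∈ V, NearCircle r x₁ γ) :
    ContDiffOn ℝ m (Function.uncurry fun (γ : CkCircle n Plane) (φ : ℝ) => invariantFormula r γ φ)
      (V ×ˢ univ) := by
  rintro ⟨γ, φ⟩ ⟨hγ, -⟩
  refine ContDiffAt.contDiffWithinAt ?_
  have hn : 2 ≤ n := by omega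
  have hp := contDiffAt_nextParam hm hm0 hV hnear hγ φ
  have hq := contDiffAt_prevParam hm hm0 hV hnear hγ φ
  have hev := CkCircle.contDiff_eval (E := Plane) hm
  have hfst : ContDiffAt ℝ m (fun z : CkCircle n Plane × ℝ => z.1) (γ, φ) := contDiffAt_fst
  have h0 : ContDiffAt ℝ m (fun z : CkCircle n Plane × ℝ => z.1 z.2) (γ, φ) := hev.contDiffAt
  have h1 : ContDiffAt ℝ m (fun z : CkCircle n Plane × ℝ => z.1 (nextParam r z.1 z.2)) (γ, φ) :=
    hev.contDiffAt.comp (γ, φ) (hfst.prodMk hp)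
  have h2 : ContDiffAt ℝ m (fun z : CkCircle n Plane × ℝ => z.1 (prevParam r z.1 z.2)) (γ, φ) :=
    hev.contDiffAt.comp (γ, φ) (hfst.prodMk hq)
  have hA := contDiff_areaForm (n := n) hm hm0 (by omega)
  have h3 := ((hA.contDiffAt.comp (γ, φ) hp).clm_apply hfst).clm_apply hfst
  have h4 := ((hA.contDiffAt.comp (γ, φ) hq).clm_apply hfst).clm_apply hfst
  have h5 := ((contDiffAt_const (c := crossCLM)).clm_apply h0).clm_apply (h1.sub h2)
  have h6 := ((h1.sub h0).inner ℝ (h2.sub h0)).div_const (r ^ 2)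
  have hlt := (hnear γ hγ).cos_angle_sq_lt_one φ
  have h7 := (Real.contDiffAt_arccos (n := m)
    (x := ⟪γ (nextParam r γ φ) - γ φ, γ (prevParam r γ φ) - γ φ⟫ / r ^ 2)
    (fun e => by rw [e] at hlt; norm_num at hlt)
    (fun e => by rw [e] at hlt; norm_num at hlt)).comp (γ, φ) h6
  refine (((contDiffAt_const (c := (1 / 2 : ℝ))).mul ((h3.sub h4).sub h5)).add
    ((contDiffAt_const (c := r ^ 2 / 2)).mul h7)).congr_of_eventuallyEq (.of_forall ?_)
  rintro ⟨γ, φ⟩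
  exact invariantFormula_eq hn r γ φ

end Smoothness

/-! ### The derivative along a straight line of curves. -/

section DirectionalDerivative

/-- The straight line through `γ` in direction `σ`. -/
def line {n : ℕ} (γ σ : CkCircle n Plane) (t : ℝ) : CkCircle n Plane := γ + t • σ

theorem line_zero {n : ℕ} (γ σ : CkCircle n Plane) : line γ σ 0 = γ := by
  rw [line, zero_smul, add_zero]

theorem hasDerivAt_line {n : ℕ} (γ σ : CkCircle n Plane) : HasDerivAt (line γ σ) σ 0 := by
  have h1 := ((hasDerivAt_id (0 : ℝ)).smul_const σ).const_add γ
  rwa [one_smul] at h1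

theorem eventually_line_mem {n : ℕ} {V : Set (CkCircle n Plane)} (hV : IsOpen V)
    {γ : CkCircle n Plane} (hγ : γ ∈ V) (σ : CkCircle n Plane) :
    ∀ᶠ t in 𝓝 (0 : ℝ), line γ σ t ∈ V := by
  refine (hasDerivAt_line γ σ).continuousAt.eventually (hV.mem_nhds ?_)
  rwa [line_zero]

variable {n : ℕ} {γ σ : CkCircle n Plane} {p : ℝ → ℝ} {P : ℝ}

theorem hasDerivAt_eval_line (hn : 1 ≤ n) (hp : HasDerivAt p P 0) :
    HasDerivAt (fun t => line γ σ t (p t)) (P • deriv γ (p 0) + σ (p 0)) 0 := by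
  have h1 := (γ.hasDerivAt hn (p 0)).scomp 0 hp
  have h2 := (hasDerivAt_id (0 : ℝ)).smul ((σ.hasDerivAt hn (p 0)).scomp 0 hp)
  refine (h1.add h2).congr_deriv ?_
  simp

theorem hasDerivAt_areaForm_line (hn : 2 ≤ n) (hp : HasDerivAt p P 0) :
    HasDerivAt (fun t => areaForm (by omega) (p t) (line γ σ t) (line γ σ t))
      (P * cross (γ (p 0)) (deriv γ (p 0)) + areaForm (by omega) (p 0) γ σ
        + areaForm (by omega) (p 0) σ γ) 0 := by
  have key := fun f g : CkCircle n Plane => (hasDerivAt_areaForm_apply hn f g (p 0)).comp 0 hp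
  have hid := hasDerivAt_id (0 : ℝ)
  -- By bilinearity the form is a polynomial of degree two in `t`, with coefficients depending on
  -- the endpoint `p t`.
  refine (((key γ γ).add (hid.mul ((key γ σ).add (key σ γ)))).add
    ((hid.mul hid).mul (key σ σ))).congr_deriv ?_ |>.congr_of_eventuallyEq (.of_forall fun t => ?_)
  · simp
    ring
  · simp only [line, map_add, map_smul, _root_.add_apply, _root_.smul_apply,
      smul_eq_mul, Pi.add_apply, Pi.mul_apply, Function.comp_apply, id_eq]
    ring

/-- Differentiating the constraint `dist = r`, squared, gives a linear equation for the velocity of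
the endpoint. -/
theorem velocity_of_dist_eq (hn : 1 ≤ n) {φ r : ℝ} (hp : HasDerivAt p P 0)
    (heq : ∀ᶠ t in 𝓝 (0 : ℝ), dist (line γ σ t (p t)) (line γ σ t φ) = r)
    (hne : ⟪deriv γ (p 0), γ (p 0) - γ φ⟫ ≠ 0) :
    P = ⟪σ φ - σ (p 0), γ (p 0) - γ φ⟫ / ⟪deriv γ (p 0), γ (p 0) - γ φ⟫ := by
  have h1 := ((hasDerivAt_eval_line (γ := γ) (σ := σ) hn hp).fun_sub
    (hasDerivAt_eval_line (γ := γ) (σ := σ) hn (hasDerivAt_const (0 : ℝ) φ))).norm_sq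
  have h2 : HasDerivAt (fun t => ‖line γ σ t (p t) - line γ σ t φ‖ ^ 2) 0 0 := by
    refine (hasDerivAt_const (0 : ℝ) (r ^ 2)).congr_of_eventuallyEq ?_
    filter_upwards [heq] with t ht
    rw [← dist_eq_norm, ht]
  have h3 := h1.unique h2
  simp only [line_zero, zero_smul, zero_add] at h3
  rw [eq_div_iff hne]
  have h4 : ⟪P • deriv γ (p 0) + σ (p 0) - σ φ, γ (p 0) - γ φ⟫ = 0 := by
    rw [real_inner_comm]
    linarith
  rw [inner_sub_left, inner_add_left, real_inner_smul_left] at h4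
  rw [inner_sub_left]
  linarith

variable {r x₁ : ℝ} {V : Set (CkCircle n Plane)}

theorem hasDerivAt_invariantFormula_line (hn : 2 ≤ n) (hV : IsOpen V)
    (hnear : ∀ γ ∈ V, NearCircle r x₁ γ) (hγ : γ ∈ V) (φ : ℝ) :
    HasDerivAt (fun t : ℝ => invariantFormula r (line γ σ t) φ)
      (1 / 2 * twiceDerivFormula r γ σ φ) 0 := by
  have h := hnear γ hγ
  have hr := h.r_pos
  have hn1 : 1 ≤ n := by omega
  have hline : HasDerivAt (fun t : ℝ => (line γ σ t, φ)) (σ, 0) 0 :=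
    (hasDerivAt_line γ σ).prodMk (hasDerivAt_const (0 : ℝ) φ)
  have hVev := eventually_line_mem hV hγ σ
  obtain ⟨P, hP⟩ : ∃ P, HasDerivAt (fun t : ℝ => nextParam r (line γ σ t) φ) P 0 := by
    have h1 := ((contDiffAt_nextParam (m := 1) (by omega) one_ne_zero hV hnear hγ
      φ).differentiableAt one_ne_zero).hasFDerivAt
    exact ⟨_, h1.comp_hasDerivAt_of_eq (0 : ℝ) hline (by rw [line_zero])⟩
  obtain ⟨M, hM⟩ : ∃ M, HasDerivAt (fun t : ℝ => prevParam r (line γ σ t) φ) M 0 := by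
    have h1 := ((contDiffAt_prevParam (m := 1) (by omega) one_ne_zero hV hnear hγ
      φ).differentiableAt one_ne_zero).hasFDerivAt
    exact ⟨_, h1.comp_hasDerivAt_of_eq (0 : ℝ) hline (by rw [line_zero])⟩
  have hPv := velocity_of_dist_eq hn1 hP
    (hVev.mono fun t ht => ((hnear _ ht).nextParam_spec φ).2.1)
    (by simpa only [line_zero] using (h.inner_nextParam_pos φ).ne')
  have hMv := velocity_of_dist_eq hn1 hM
    (hVev.mono fun t ht => ((hnear _ ht).prevParam_spec φ).2.1)
    (by simpa only [line_zero] using (h.inner_prevParam_neg φ).ne)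
  have d0 := hasDerivAt_eval_line (γ := γ) (σ := σ) hn1 (hasDerivAt_const (0 : ℝ) φ)
  have dp := hasDerivAt_eval_line (γ := γ) (σ := σ) hn1 hP
  have dm := hasDerivAt_eval_line (γ := γ) (σ := σ) hn1 hM
  have ap := hasDerivAt_areaForm_line (γ := γ) (σ := σ) hn hP
  have am := hasDerivAt_areaForm_line (γ := γ) (σ := σ) hn hM
  have hlt := h.cos_angle_sq_lt_one φ
  have dcos := ((dp.fun_sub d0).inner ℝ (dm.fun_sub d0)).div_const (r ^ 2)
  have darc := HasDerivAt.comp (0 : ℝ) (h₂ := Real.arccos) (Real.hasDerivAt_arccos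
    (fun e => by
      simp only [line_zero] at e
      rw [e] at hlt
      norm_num at hlt)
    (fun e => by
      simp only [line_zero] at e
      rw [e] at hlt
      norm_num at hlt)) dcos
  have htot := (((ap.fun_sub am).fun_sub (d0.cross (dp.fun_sub dm))).const_mul (1 / 2)).fun_add
    (darc.const_mul (r ^ 2 / 2))
  refine (htot.congr_deriv ?_).congr_of_eventuallyEq
    (.of_forall fun t => invariantFormula_eq hn r (line γ σ t) φ)
  simp only [line_zero, zero_smul, zero_add] at hPv hMv ⊢
  have hsqrt : √(1 - (⟪γ (nextParam r γ φ) - γ φ, γ (prevParam r γ φ) - γ φ⟫ / r ^ 2) ^ 2) =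
      √(r ^ 4 - ⟪γ (nextParam r γ φ) - γ φ, γ (prevParam r γ φ) - γ φ⟫ ^ 2) / r ^ 2 := by
    rw [← Real.sqrt_sq (show 0 ≤ r ^ 2 by positivity), ← Real.sqrt_div' _ (by positivity),
      Real.sqrt_sq (by positivity)]
    congr 1
    field_simp
  have hpos : 0 < √(r ^ 4 - ⟪γ (nextParam r γ φ) - γ φ, γ (prevParam r γ φ) - γ φ⟫ ^ 2) :=
    Real.sqrt_pos.2 (h.nonDegenerate φ).2.2
  rw [hsqrt, twiceDerivFormula]
  simp only [← hPv, ← hMv, inner_perp]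
  -- Integration by parts trades `deriv σ` for `deriv γ`; the boundary terms at the base point `0`
  -- cancel between the two endpoints.
  rw [areaForm_swap hn (nextParam r γ φ) γ σ, areaForm_swap hn (prevParam r γ φ) γ σ,
    integral_cross_eq_areaForm hn, inner_perp_sub_perp]
  generalize √_ = D at hpos ⊢
  simp only [cross_add_right, cross_sub_right, cross_sub_left,
    cross_smul_right, inner_add_left, inner_add_right, inner_sub_left, inner_sub_right,
    real_inner_smul_left, real_inner_smul_right]
  field_simp
  ring

end DirectionalDerivative

end CircInv

end

/-! ### Assembly of the theorem. -/

theorem mainTheorem2 (k ℓ : ℕ) (hℓ : 1 ≤ ℓ) (r R : ℝ) (hr : 0 < r) (hR : r / 2 < R) :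
    ∃ V : Set (CircInv.CkCircle (k + ℓ + 1) CircInv.Plane),
      IsOpen V ∧ CircInv.circleCurve (k + ℓ + 1) R ∈ V ∧
      (∀ γ ∈ V, CircInv.IsEmbedded γ) ∧
      (∀ γ ∈ V, ∀ φ : ℝ, CircInv.MeetsTwice r γ φ ∧ CircInv.NonDegenerate r γ φ) ∧
      (∀ γ ∈ V, ∀ φ : ℝ, CircInv.invariant r γ φ = CircInv.invariantFormula r γ φ) ∧
      ∃ J : CircInv.CkCircle (k + ℓ + 1) CircInv.Plane → CircInv.CkCircle k ℝ,
        (∀ γ ∈ V, ∀ φ : ℝ, J γ φ = CircInv.invariant r γ φ) ∧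
        ContDiffOn ℝ ℓ J V ∧
        ∀ γ ∈ V, ∀ (σ : CircInv.CkCircle (k + ℓ + 1) CircInv.Plane) (φ : ℝ),
          2 * (fderiv ℝ J γ σ) φ = CircInv.twiceDerivFormula r γ σ φ := by
  have hn : 2 ≤ k + ℓ + 1 := by omega
  obtain ⟨x₁, ε, hε, hnear⟩ := CircInv.exists_nearCircle hn hr hR
  set V := Metric.ball (CircInv.circleCurve (k + ℓ + 1) R) ε
  have hV : IsOpen V := Metric.isOpen_ball
  have hF := CircInv.contDiffOn_invariantFormula (m := k + ℓ) le_rfl (by omega) hV hnear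
  have hI : ∀ γ ∈ V, ∀ φ, CircInv.invariant r γ φ = CircInv.invariantFormula r γ φ :=
    fun γ hγ φ => (hnear γ hγ).invariant_eq_invariantFormula φ
  have hper : ∀ γ : CircInv.CkCircle (k + ℓ + 1) CircInv.Plane,
      Function.Periodic (CircInv.invariant r γ) (2 * π) := fun γ φ => by
    simp only [CircInv.invariant, γ.periodic φ]
  have hsm : ∀ γ ∈ V, ContDiff ℝ k (CircInv.invariant r γ) := by
    intro γ hγ
    rw [funext (hI γ hγ)]
    exact (CircInv.contDiff_of_contDiffOn_uncurry hF hγ).of_le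
      (by exact_mod_cast Nat.le_add_right k ℓ)
  classical
  -- The value `0` off `V` is immaterial: `V` is open, so `fderiv` at a point of `V` sees only
  -- values in `V`.
  let J : CircInv.CkCircle (k + ℓ + 1) CircInv.Plane → CircInv.CkCircle k ℝ := fun γ =>
    if hγ : γ ∈ V then .ofPeriodic (CircInv.invariant r γ) (hper γ) (hsm γ hγ) else 0
  have hJ : ∀ γ ∈ V, ∀ φ, J γ φ = CircInv.invariant r γ φ := fun γ hγ φ => by simp [J, hγ]
  have hJs : ContDiffOn ℝ ℓ J V := CircInv.contDiffOn_ckCircle_of_uncurry ℓ hV hF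
    fun γ hγ φ => (hJ γ hγ φ).trans (hI γ hγ φ)
  refine ⟨V, hV, Metric.mem_ball_self hε, fun γ hγ => (hnear γ hγ).isEmbedded,
    fun γ hγ φ => ⟨(hnear γ hγ).meetsTwice φ, (hnear γ hγ).nonDegenerate φ⟩, hI, J, hJ, hJs, ?_⟩
  intro γ hγ σ φ
  have hd : DifferentiableAt ℝ J γ := (hJs.contDiffAt (hV.mem_nhds hγ)).differentiableAt
    (by exact_mod_cast (by omega : ℓ ≠ 0))
  -- Evaluation at `φ` commutes with the derivative, so uniqueness of scalar derivatives identifies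
  -- `fderiv ℝ J γ σ` pointwise.
  have h1 := (CircInv.CkCircle.evJet (k := k) (E := ℝ) (Nat.zero_le k)
    φ).hasFDerivAt.comp_hasDerivAt (0 : ℝ) (hd.hasFDerivAt.comp_hasDerivAt_of_eq (0 : ℝ)
      (CircInv.hasDerivAt_line γ σ) (CircInv.line_zero γ σ).symm)
  rw [CircInv.CkCircle.evJet_zero_apply] at h1
  have h2 := CircInv.hasDerivAt_invariantFormula_line (σ := σ) hn hV hnear hγ φ
  have h3 := h1.unique (h2.congr_of_eventuallyEq
    ((CircInv.eventually_line_mem hV hγ σ).mono fun t ht => by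
      rw [Function.comp_apply, CircInv.CkCircle.evJet_zero_apply, Function.comp_apply, hJ _ ht,
        hI _ ht]))
  rw [h3]
  ring
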